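/- For an integer $k\ge 0$ put $\delta_k=1$ if $k=0$ and $\delta_k=0$ otherwise. Let $K_\nu$ be the modified Bessel function, $K_\nu(z)=\frac{\pi}{2}\,\frac{I_{-\nu}(z)-I_\nu(z)}{\sin \pi\nu}$ for $\nu\notin\mathbb Z$ (and the limit in $\nu$ for $\nu\in\mathbb Z$), where $I_\nu(z)=\sum_{n\ge0}\frac{(z/2)^{\nu+2n}}{n!\,\Gamma(\nu+n+1)}$. Let $\zeta(s,\alpha)$ be the (analytically continued) Hurwitz zeta function, $\zeta(s,\alpha)=\sum_{n\ge 0}(n+\alpha)^{-s}$ for $\Re s>1$; the difference $\zeta(s,\theta)-\zeta(s,1-\theta)$ is entire in $s$, and at $s=1$ it denotes the limiting value. **Theorem.** Let $k\ge 0$ be an even integer, $\nu\in\mathbb C$ with $\Re\nu>0$, and $a,x>0$. (i) For every $0<\theta<1$, $$\begin{aligned} &\Big(\frac{a^2x}{4}\Big)^{\frac{\nu}{2}+k+1}\sum_{n=1}^{\infty} n^{\nu/2}K_\nu(a\sqrt{nx})\sum_{d\mid n}d^k\sin(2\pi d\theta)\\ &= -\frac{(-1)^{k/2}a^{2k+2}k!}{2^{2k+4}(2\pi)^{k+1}}\,\Gamma(\nu)\,\big(\zeta(1+k,\theta)-\zeta(1+k,1-\theta)\big)x^{k+1}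 +\delta_k\frac{\pi\,\Gamma(1+\nu)}{4}\big(\zeta(0,\theta)-\zeta(0,1-\theta)\big)\\ &\quad+\frac{(-1)^{k/2}}{4}(2\pi)^{k+1}\sum_{d=1}^{\infty}d^k\sum_{m=0}^{\infty}\left\{\frac{\Gamma(\nu+k+1)}{\big(1+\frac{16\pi^2d}{a^2x}(m+\theta)\big)^{1+\nu+k}}-\frac{\Gamma(\nu+k+1)}{\big(1+\frac{16\pi^2d}{a^2x}(m+1-\theta)\big)^{1+\nu+k}}\right\}, \end{aligned}\tag{1}$$ where the series on the left and the double series (over pairs $(d,m)$) on the right converge absolutely. (ii) For these $k,\nu,a,x$, the validity of (1) for all $0<\theta<1$ is equivalent to the validity, for all $q\ge 1$ and all odd primitive Dirichlet characters $\chi$ modulo $q$, of $$\begin{aligned} &\Big(\frac{a^2x}{4}\Big)^{\frac{\nu}{2}+k+1}\sum_{n=1}^\infty\sigma_{k,\chi}(n)\,n^{\nu/2}K_\nu(a\sqrt{nx})\\ &=\frac{(-1)^{k/2}\,i\,k!\,q^ka^{2k+2}}{2^{2k+3}(2\pi)^{k+1}}\,\Gamma(\nu)\,\tau(\chi)\,L(1+k,\bar\chi)\,x^{k+1}+\delta_k\frac{\Gamma(1+\nu)L(1,\chi)}{2}\\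 &\quad-\frac{(-1)^{k/2}\,i}{2q}\,\tau(\chi)(2\pi)^{k+1}\sum_{n=1}^\infty\bar\sigma_{k,\bar\chi}(n)\frac{\Gamma(\nu+k+1)}{\big(\frac{16\pi^2}{a^2q}\frac{n}{x}+1\big)^{\nu+k+1}}, \end{aligned}\tag{2}$$ where both series converge absolutely; in particular (2) holds for all such $\chi$. Here $\sigma_{k,\chi}(n)=\sum_{d\mid n}d^k\chi(d)$, $\bar\sigma_{k,\chi}(n)=\sum_{d\mid n}d^k\chi(n/d)$, $\tau(\chi)=\sum_{h=1}^{q}\chi(h)e^{2\pi i h/q}$, and $L(s,\chi)$ is the Dirichlet $L$-function. -/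

import Mathlib

open Filter Topology HurwitzZeta

/-- The Bessel function of imaginary argument
`I_ν(z) = ∑_{n ≥ 0} (z/2)^(ν+2n) / (n! Γ(ν+n+1))` (principal branch of the power).
Where `ν + n + 1` is a pole of `Γ`, Mathlib has `Γ = 0`, so that the quotient is `0`, in agreement
with the usual convention `1/Γ = 0` there. -/
noncomputable def besselI (ν z : ℂ) : ℂ :=
  ∑' n : ℕ, (z / 2) ^ (ν + 2 * (n : ℂ)) / ((n.factorial : ℂ) * Complex.Gamma (ν + n + 1))

/-- The quotient `(π/2) (I_{-ν}(z) - I_ν(z)) / sin(πν)`, meaningful for `ν ∉ ℤ`. -/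
noncomputable def besselKAux (ν z : ℂ) : ℂ :=
  (Real.pi : ℂ) / 2 * ((besselI (-ν) z - besselI ν z) / Complex.sin (Real.pi * ν))

open Classical in
/-- The modified Bessel function `K_ν(z)`: it is `(π/2) (I_{-ν}(z) - I_ν(z)) / sin(πν)` for
`ν ∉ ℤ`, and the limit of that quotient in the order for `ν ∈ ℤ`. -/
noncomputable def besselK (ν z : ℂ) : ℂ :=
  if ∃ m : ℤ, ν = m then limUnder (𝓝[≠] ν) (fun μ : ℂ => besselKAux μ z) else besselKAux ν z

/-- `ζ(s, θ) - ζ(s, 1 - θ)`, a difference of two Hurwitz zeta functions. Both have a simple pole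
at `s = 1` with residue `1`; the difference is entire, and its value at `s = 1` is the limiting
value, see `tendsto_hurwitzDiff`. -/
noncomputable def hurwitzDiff (θ : ℝ) (s : ℂ) : ℂ :=
  hurwitzZeta (θ : UnitAddCircle) s - hurwitzZeta ((1 - θ : ℝ) : UnitAddCircle) s

theorem tendsto_hurwitzDiff (θ : ℝ) (s : ℂ) :
    Tendsto (fun w : ℂ => hurwitzZeta (θ : UnitAddCircle) w -
      hurwitzZeta ((1 - θ : ℝ) : UnitAddCircle) w) (𝓝[≠] s) (𝓝 (hurwitzDiff θ s)) :=
  ((differentiable_hurwitzZeta_sub_hurwitzZeta _ _).continuous.tendsto s).mono_left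
    nhdsWithin_le_nhds

/-- The symbol `δ_k`: it is `1` for `k = 0` and `0` otherwise. -/
def deltaK (k : ℕ) : ℂ := if k = 0 then 1 else 0

/-- `∑_{d ∣ n} d^k sin(2πdθ)`. -/
noncomputable def sinDivisorSum (k : ℕ) (θ : ℝ) (n : ℕ+) : ℂ :=
  ∑ d ∈ (n : ℕ).divisors, (d : ℂ) ^ k * (Real.sin (2 * Real.pi * d * θ) : ℂ)

/-- `σ_{k,χ}(n) = ∑_{d ∣ n} d^k χ(d)`. -/
noncomputable def twistedSigma (k : ℕ) {q : ℕ} (χ : DirichletCharacter ℂ q) (n : ℕ+) : ℂ :=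
  ∑ d ∈ (n : ℕ).divisors, (d : ℂ) ^ k * χ ((d : ℕ) : ZMod q)

/-- `σ̄_{k,χ}(n) = ∑_{d ∣ n} d^k χ(n/d)`. -/
noncomputable def twistedSigmaBar (k : ℕ) {q : ℕ} (χ : DirichletCharacter ℂ q) (n : ℕ+) : ℂ :=
  ∑ d ∈ (n : ℕ).divisors, (d : ℂ) ^ k * χ (((n : ℕ) / d : ℕ) : ZMod q)

/-- `n^{ν/2} K_ν(a √(n x))`. -/
noncomputable def besselWeight (ν : ℂ) (a x : ℝ) (n : ℕ+) : ℂ :=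
  ((n : ℕ) : ℂ) ^ (ν / 2) * besselK ν ((a * Real.sqrt ((n : ℕ) * x) : ℝ) : ℂ)

/-- `Γ(ν+k+1) / (1 + (16π²d / (a²x)) t)^{1+ν+k}`. -/
noncomputable def gammaQuot (k : ℕ) (ν : ℂ) (a x : ℝ) (d : ℕ+) (t : ℝ) : ℂ :=
  Complex.Gamma (ν + k + 1) /
    ((1 + 16 * Real.pi ^ 2 * (d : ℕ) / (a ^ 2 * x) * t : ℝ) : ℂ) ^ (1 + ν + k)

/-- The trigonometric identity with parameters `k, ν, a, x, θ`: the series on the left and the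
double series on the right converge absolutely, and

`(a²x/4)^{ν/2+k+1} ∑_{n ≥ 1} n^{ν/2} K_ν(a√(nx)) ∑_{d ∣ n} d^k sin(2πdθ)`
`= - (-1)^{k/2} a^{2k+2} k! / (2^{2k+4} (2π)^{k+1}) Γ(ν) (ζ(1+k,θ) - ζ(1+k,1-θ)) x^{k+1}`
`+ δ_k (π Γ(1+ν) / 4) (ζ(0,θ) - ζ(0,1-θ))`
`+ ((-1)^{k/2} / 4) (2π)^{k+1} ∑_{d ≥ 1} d^k ∑_{m ≥ 0}`
`{ Γ(ν+k+1) / (1 + 16π²d(m+θ)/(a²x))^{1+ν+k} - Γ(ν+k+1) / (1 + 16π²d(m+1-θ)/(a²x))^{1+ν+k} }`. -/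
def TrigIdentity (k : ℕ) (ν : ℂ) (a x θ : ℝ) : Prop :=
  Summable (fun n : ℕ+ => besselWeight ν a x n * sinDivisorSum k θ n) ∧
  Summable (fun p : ℕ+ × ℕ => ((p.1 : ℕ) : ℂ) ^ k *
    (gammaQuot k ν a x p.1 (p.2 + θ) - gammaQuot k ν a x p.1 (p.2 + 1 - θ))) ∧
  ((a ^ 2 * x / 4 : ℝ) : ℂ) ^ (ν / 2 + k + 1) *
      ∑' n : ℕ+, besselWeight ν a x n * sinDivisorSum k θ n =
    -((-1 : ℂ) ^ (k / 2) * (a : ℂ) ^ (2 * k + 2) * (k.factorial : ℂ) /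
        (2 ^ (2 * k + 4) * (2 * (Real.pi : ℂ)) ^ (k + 1))) *
        Complex.Gamma ν * hurwitzDiff θ (1 + k) * (x : ℂ) ^ (k + 1)
    + deltaK k * ((Real.pi : ℂ) * Complex.Gamma (1 + ν) / 4) * hurwitzDiff θ 0
    + (-1 : ℂ) ^ (k / 2) / 4 * (2 * (Real.pi : ℂ)) ^ (k + 1) *
        ∑' d : ℕ+, ((d : ℕ) : ℂ) ^ k * ∑' m : ℕ,
          (gammaQuot k ν a x d (m + θ) - gammaQuot k ν a x d (m + 1 - θ))

/-- The character identity with parameters `k, ν, a, x` and a Dirichlet character `χ` modulo `q`: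
both series converge absolutely, and

`(a²x/4)^{ν/2+k+1} ∑_{n ≥ 1} σ_{k,χ}(n) n^{ν/2} K_ν(a√(nx))`
`= ((-1)^{k/2} i k! q^k a^{2k+2} / (2^{2k+3} (2π)^{k+1})) Γ(ν) τ(χ) L(1+k, χ̄) x^{k+1}`
`+ δ_k Γ(1+ν) L(1,χ) / 2`
`- ((-1)^{k/2} i / (2q)) τ(χ) (2π)^{k+1} ∑_{n ≥ 1} σ̄_{k,χ̄}(n) Γ(ν+k+1) / (16π²n/(a²qx) + 1)^{ν+k+1}`.

Here `τ(χ) = ∑_{h mod q} χ(h) e^{2πih/q}`, and `χ⁻¹` is the complex conjugate `χ̄` of `χ`. -/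
def CharIdentity (k : ℕ) (ν : ℂ) (a x : ℝ) (q : ℕ) [NeZero q]
    (χ : DirichletCharacter ℂ q) : Prop :=
  Summable (fun n : ℕ+ => twistedSigma k χ n * besselWeight ν a x n) ∧
  Summable (fun n : ℕ+ => twistedSigmaBar k χ⁻¹ n * (Complex.Gamma (ν + k + 1) /
    ((16 * Real.pi ^ 2 / (a ^ 2 * q) * ((n : ℕ) / x) + 1 : ℝ) : ℂ) ^ (ν + k + 1))) ∧
  ((a ^ 2 * x / 4 : ℝ) : ℂ) ^ (ν / 2 + k + 1) *
      ∑' n : ℕ+, twistedSigma k χ n * besselWeight ν a x n =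
    (-1 : ℂ) ^ (k / 2) * Complex.I * (k.factorial : ℂ) * (q : ℂ) ^ k * (a : ℂ) ^ (2 * k + 2) /
        (2 ^ (2 * k + 3) * (2 * (Real.pi : ℂ)) ^ (k + 1)) *
        Complex.Gamma ν * gaussSum χ ZMod.stdAddChar *
        DirichletCharacter.LFunction χ⁻¹ (1 + k) * (x : ℂ) ^ (k + 1)
    + deltaK k * (Complex.Gamma (1 + ν) * DirichletCharacter.LFunction χ 1 / 2)
    - (-1 : ℂ) ^ (k / 2) * Complex.I / (2 * (q : ℂ)) * gaussSum χ ZMod.stdAddChar *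
        (2 * (Real.pi : ℂ)) ^ (k + 1) *
        ∑' n : ℕ+, twistedSigmaBar k χ⁻¹ n * (Complex.Gamma (ν + k + 1) /
          ((16 * Real.pi ^ 2 / (a ^ 2 * q) * ((n : ℕ) / x) + 1 : ℝ) : ℂ) ^ (ν + k + 1))

/-! Put y = a²x/4 and J_ν(y) = ∫_0^∞ t^(ν-1) e^(-t-y/t) dt. Since K_ν(2w) = w^(-ν) J_ν(w²)/2
(`besselK_two_mul`), the left side of (1) is, up to a power of y, the integral against t^(ν-1)
e^(-t) of the Lambert-type series ∑ s(n) e^(-ny/t), where s(n) = ∑_{d∣n} d^k sin(2πdθ). That series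
is half of a twisted Eisenstein series of odd weight k+1, and its transformation law turns it into a
series in e^(-4π²d(m+θ)t/y) and e^(-4π²d(m+1-θ)t/y). Integrating the transformed series term by term
gives Gamma integrals, which are the terms on the right of (1).

The transformation law (`modularDefect_eq`) comes from summing (θ + n + m·iT)^(-(k+1)) over the
lattice in both orders. Rows and columns are evaluated by Lipschitz's formula, except the row m = 0,
which is ζ(1+k,θ) - ζ(1+k,1-θ). For even k ≥ 2 the lattice sum converges absolutely, and the two
orders agree. For k = 0 it does not. A combination of three values of θ with ∑c_i = ∑c_iθ_i = 0
restores cubic decay, so the discrepancy between the two orders is an affine function of θ. It is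
odd under θ ↦ 1-θ, hence a multiple of 1-2θ = ζ(0,θ) - ζ(0,1-θ). Letting θ → 0+ shows that the
multiple is π/T. This is the source of the δ_k term.

The integral formula for K_ν, which is defined here through I_{±ν}, is obtained without a
differential equation of second order. J_ν and the power series of I_ν satisfy first-order
contiguity relations, so two Wronskian-like bilinear expressions are constant in y. Evaluating the
constants at y = 0 and solving the resulting linear system gives J_ν sin(πν)/π as the difference of
the two series.

For (2), an odd primitive character is a combination of sines: χ(d) = -(iτ(χ)/q) ∑_h χ̄(h)
sin(2πdh/q). Summing (1) at θ = h/q with weights χ̄(h) yields (2), with L(0,χ̄) converted to L(1,χ)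
by the functional equation. The converse implication in (ii) is immediate, because (i) is proved
unconditionally. -/

open MeasureTheory Set Asymptotics

/-! ### The integral J_ν(y) = ∫ t^(ν-1) e^(-t-y/t) dt and its contiguity relations. -/

/-- The kernel `exp (-(t + y / t))`, whose Mellin transform is a modified Bessel function. -/
noncomputable def besselKernel (y t : ℝ) : ℂ := (Real.exp (-(t + y / t)) : ℂ)

/-- `∫_0^∞ t^{ν-1} exp (-(t + y / t)) dt`. -/
noncomputable def besselMellin (ν : ℂ) (y : ℝ) : ℂ := mellin (besselKernel y) ν

lemma norm_besselKernel (y t : ℝ) : ‖besselKernel y t‖ = Real.exp (-(t + y / t)) := by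
  rw [besselKernel, Complex.norm_real, Real.norm_eq_abs, Real.abs_exp]

lemma Real.exp_neg_le_factorial_div_pow {u : ℝ} (hu : 0 < u) (N : ℕ) :
    Real.exp (-u) ≤ N.factorial / u ^ N := by
  have h := Real.pow_div_factorial_le_exp u hu.le N
  rw [Real.exp_neg, ← inv_div]
  exact inv_anti₀ (by positivity) h

lemma continuousOn_besselKernel (y : ℝ) : ContinuousOn (besselKernel y) (Ioi 0) := by
  unfold besselKernel
  refine Complex.continuous_ofReal.comp_continuousOn (Real.continuous_exp.comp_continuousOn ?_)
  refine (continuousOn_id.add (continuousOn_const.div continuousOn_id ?_)).neg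
  exact fun t ht => (mem_Ioi.1 ht).ne'

lemma besselKernel_isBigO_atTop {y : ℝ} (hy : 0 ≤ y) :
    besselKernel y =O[atTop] fun t : ℝ => Real.exp (-1 * t) := by
  refine IsBigO.of_bound 1 ?_
  filter_upwards [eventually_gt_atTop 0] with t ht
  rw [norm_besselKernel, one_mul, Real.norm_eq_abs, Real.abs_exp]
  have : 0 ≤ y / t := by positivity
  gcongr
  linarith

/-- The factor e^(-y/t) vanishes at 0 to every order, so the Mellin transform converges for all
complex ν, not only in a half-plane. -/
lemma besselKernel_isBigO_zero {y : ℝ} (hy : 0 < y) (b : ℝ) :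
    besselKernel y =O[𝓝[>] 0] fun t : ℝ => t ^ (-b) := by
  obtain ⟨N, hN⟩ := exists_nat_ge (-b)
  refine IsBigO.of_bound (N.factorial / y ^ N) ?_
  filter_upwards [Ioo_mem_nhdsGT (zero_lt_one' ℝ)] with t ht
  have h0 : 0 < t := ht.1
  rw [norm_besselKernel, Real.norm_eq_abs, abs_of_nonneg (by positivity)]
  calc Real.exp (-(t + y / t)) ≤ Real.exp (-(y / t)) := by gcongr; linarith
    _ ≤ N.factorial / (y / t) ^ N := Real.exp_neg_le_factorial_div_pow (by positivity) N
    _ = N.factorial / y ^ N * t ^ (N : ℝ) := by rw [Real.rpow_natCast, div_pow]; field_simp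
    _ ≤ _ := mul_le_mul_of_nonneg_left (Real.rpow_le_rpow_of_exponent_ge h0 ht.2.le hN)
        (by positivity)

lemma besselKernel_mellinConvergent {y : ℝ} (hy : 0 < y) (ν : ℂ) :
    MellinConvergent (besselKernel y) ν :=
  mellinConvergent_of_isBigO_rpow_exp one_pos
    ((continuousOn_besselKernel y).locallyIntegrableOn measurableSet_Ioi)
    (besselKernel_isBigO_atTop hy.le) (besselKernel_isBigO_zero hy (ν.re - 1)) (by linarith)

lemma differentiableAt_besselMellin {y : ℝ} (hy : 0 < y) (ν : ℂ) :
    DifferentiableAt ℂ (fun μ => besselMellin μ y) ν :=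
  mellin_differentiableAt_of_isBigO_rpow_exp one_pos
    ((continuousOn_besselKernel y).locallyIntegrableOn measurableSet_Ioi)
    (besselKernel_isBigO_atTop hy.le) (besselKernel_isBigO_zero hy (ν.re - 1)) (by linarith)

/-- The substitution t ↦ y/t leaves t + y/t unchanged. -/
lemma besselMellin_eq_cpow_mul {y : ℝ} (hy : 0 < y) (ν : ℂ) :
    besselMellin ν y = (y : ℂ) ^ ν * besselMellin (-ν) y := by
  have h : mellin (besselKernel y) ν = mellin (fun t => besselKernel y (y * t⁻¹)) ν := by
    refine setIntegral_congr_fun measurableSet_Ioi fun t ht => ?_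
    have ht : t ≠ 0 := (mem_Ioi.1 ht).ne'
    have e : y * t⁻¹ + y / (y * t⁻¹) = t + y / t := by field_simp; ring
    simp only [besselKernel, e]
  rw [besselMellin, h, mellin_comp_inv (fun t => besselKernel y (y * t)),
    mellin_comp_mul_left _ _ hy, neg_neg, smul_eq_mul, besselMellin]

lemma besselMellin_hasDerivAt (ν : ℂ) {y : ℝ} (hy : 0 < y) :
    HasDerivAt (besselMellin ν) (-besselMellin (ν - 1) y) y := by
  have key := hasDerivAt_integral_of_dominated_loc_of_deriv_le
    (μ := volume.restrict (Ioi (0 : ℝ))) (x₀ := y) (s := Ioi (y / 2))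
    (F := fun y t => (t : ℂ) ^ (ν - 1) • besselKernel y t)
    (F' := fun y t => -((t : ℂ) ^ (ν - 1 - 1) • besselKernel y t))
    -- For parameters z > y/2 the derivative of the integrand is dominated by its value at y/2.
    (bound := fun t => ‖(t : ℂ) ^ (ν - 1 - 1) • besselKernel (y / 2) t‖)
    (Ioi_mem_nhds (by linarith)) ?_ (besselKernel_mellinConvergent hy ν)
    (besselKernel_mellinConvergent hy (ν - 1)).neg.aestronglyMeasurable ?_
    (besselKernel_mellinConvergent (half_pos hy) (ν - 1)).norm ?_
  · have := key.2
    rw [integral_neg] at this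
    exact this
  · filter_upwards [lt_mem_nhds hy] with z hz
    exact (besselKernel_mellinConvergent hz ν).aestronglyMeasurable
  · refine (ae_restrict_iff' measurableSet_Ioi).2 (.of_forall fun t ht z hz => ?_)
    have ht : 0 < t := ht
    rw [norm_neg, norm_smul, norm_smul, norm_besselKernel, norm_besselKernel]
    have : y / 2 < z := hz
    gcongr
  · refine (ae_restrict_iff' measurableSet_Ioi).2 (.of_forall fun t ht z hz => ?_)
    have ht : 0 < t := ht
    have h1 : HasDerivAt (fun z : ℝ => Real.exp (-(t + z / t)))
        (Real.exp (-(t + z / t)) * (-(1 / t))) z :=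
      ((((hasDerivAt_id z).div_const t).const_add t).neg).exp
    have h2 := (h1.ofReal_comp).const_mul ((t : ℂ) ^ (ν - 1))
    refine h2.congr_deriv ?_
    have ht' : (t : ℂ) ≠ 0 := by exact_mod_cast ht.ne'
    rw [Complex.cpow_sub (ν - 1) 1 ht', Complex.cpow_one]
    simp only [besselKernel, smul_eq_mul]
    push_cast
    field_simp

lemma tendsto_cpow_mul_besselKernel_zero {y : ℝ} (hy : 0 < y) (ν : ℂ) :
    Tendsto (fun t : ℝ => (t : ℂ) ^ ν * besselKernel y t) (𝓝[>] 0) (𝓝 0) := by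
  have h1 : (fun t : ℝ => (t : ℂ) ^ ν) =O[𝓝[>] 0] fun t : ℝ => t ^ ν.re := by
    refine IsBigO.of_bound 1 ?_
    filter_upwards [self_mem_nhdsWithin] with t ht
    have ht : 0 < t := ht
    rw [Complex.norm_cpow_eq_rpow_re_of_pos ht, Real.norm_eq_abs, one_mul]
    exact le_abs_self _
  have h2 := h1.mul (besselKernel_isBigO_zero hy (ν.re - 1))
  refine h2.trans_tendsto ?_
  refine (tendsto_nhdsWithin_of_tendsto_nhds (f := fun t : ℝ => t) (a := (0:ℝ))
    (s := Ioi 0) tendsto_id).congr' ?_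
  filter_upwards [self_mem_nhdsWithin] with t ht
  rw [← Real.rpow_add ht]
  simp

lemma tendsto_cpow_mul_besselKernel_atTop {y : ℝ} (hy : 0 < y) (ν : ℂ) :
    Tendsto (fun t : ℝ => (t : ℂ) ^ ν * besselKernel y t) atTop (𝓝 0) := by
  have h1 : (fun t : ℝ => (t : ℂ) ^ ν) =O[atTop] fun t : ℝ => t ^ ν.re := by
    refine IsBigO.of_bound 1 ?_
    filter_upwards [eventually_gt_atTop 0] with t ht
    rw [Complex.norm_cpow_eq_rpow_re_of_pos ht, Real.norm_eq_abs, one_mul]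
    exact le_abs_self _
  exact (h1.mul (besselKernel_isBigO_atTop hy.le)).trans_tendsto
    (tendsto_rpow_mul_exp_neg_mul_atTop_nhds_zero _ 1 one_pos)

/-- Integrate the derivative of t^ν e^(-t-y/t) over (0, ∞); the boundary terms vanish at both ends.
-/
lemma besselMellin_add_one {y : ℝ} (hy : 0 < y) (ν : ℂ) :
    besselMellin (ν + 1) y = ν * besselMellin ν y + y * besselMellin (ν - 1) y := by
  have hp := besselKernel_mellinConvergent hy (ν + 1)
  have h0 := besselKernel_mellinConvergent hy ν
  have hm := besselKernel_mellinConvergent hy (ν - 1)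
  unfold MellinConvergent at hp h0 hm
  have hcp : ∀ t ∈ Ioi (0 : ℝ), (t : ℂ) ^ (ν + 1 - 1) = (t : ℂ) ^ ν := fun t _ => by ring_nf
  have hcm : ∀ t ∈ Ioi (0 : ℝ), (t : ℂ) ^ (ν - 1 - 1) = (t : ℂ) ^ ν / t ^ 2 := fun t ht => by
    have ht' : (t : ℂ) ≠ 0 := by exact_mod_cast (mem_Ioi.1 ht).ne'
    rw [Complex.cpow_sub _ _ ht', Complex.cpow_sub _ _ ht', Complex.cpow_one]
    field_simp
  have hint : IntegrableOn (fun t : ℝ => (t : ℂ) ^ ν * (besselKernel y t * (-1 + y / t ^ 2)))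
      (Ioi 0) := by
    refine (hp.neg.add (hm.smul (y : ℂ))).congr_fun (fun t ht => ?_) measurableSet_Ioi
    simp only [Pi.add_apply, Pi.neg_apply, Pi.smul_apply, smul_eq_mul, hcp t ht, hcm t ht]
    ring
  have h := integral_Ioi_mul_deriv_eq_deriv_mul (a := (0 : ℝ)) (a' := (0 : ℂ)) (b' := (0 : ℂ))
    (u := fun t : ℝ => (t : ℂ) ^ ν) (u' := fun t : ℝ => ν * (t : ℂ) ^ (ν - 1))
    (v := besselKernel y) (v' := fun t => besselKernel y t * (-1 + y / t ^ 2))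
    ?_ ?_ hint ?_ (tendsto_cpow_mul_besselKernel_zero hy ν)
    (tendsto_cpow_mul_besselKernel_atTop hy ν)
  · have e1 : ∫ t in Ioi (0 : ℝ), (t : ℂ) ^ ν * (besselKernel y t * (-1 + y / t ^ 2))
        = - besselMellin (ν + 1) y + y * besselMellin (ν - 1) y := by
      rw [besselMellin, besselMellin, mellin, mellin, ← integral_neg, ← integral_const_mul]
      refine Eq.trans ?_ (integral_add hp.neg (hm.const_mul (y : ℂ)))
      refine setIntegral_congr_fun measurableSet_Ioi fun t ht => ?_
      simp only [smul_eq_mul, hcp t ht, hcm t ht]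
      ring
    have e2 : ∫ t in Ioi (0 : ℝ), ν * (t : ℂ) ^ (ν - 1) * besselKernel y t
        = ν * besselMellin ν y := by
      rw [besselMellin, mellin, ← integral_const_mul]
      simp only [smul_eq_mul, mul_assoc]
    rw [e1, e2] at h
    linear_combination -h
  · intro t ht
    rcases eq_or_ne ν 0 with rfl | h
    · simpa using hasDerivAt_const t (1 : ℂ)
    · exact hasDerivAt_ofReal_cpow_const (mem_Ioi.1 ht).ne' h
  · intro t ht
    have ht0 : t ≠ 0 := (mem_Ioi.1 ht).ne'
    have h1 : HasDerivAt (fun t : ℝ => Real.exp (-(t + y / t)))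
        (Real.exp (-(t + y / t)) * (-(1 + -y / t ^ 2))) t := by
      refine HasDerivAt.exp (((hasDerivAt_id t).add ?_).neg)
      refine ((hasDerivAt_inv ht0).const_mul y).congr_deriv ?_
      ring
    refine h1.ofReal_comp.congr_deriv ?_
    simp only [besselKernel]
    push_cast
    ring
  · refine IntegrableOn.congr_fun (h0.smul ν) (fun t _ => ?_) measurableSet_Ioi
    simp only [smul_eq_mul, Pi.mul_apply, Pi.smul_apply]
    ring

lemma tendsto_besselMellin_zero {ν : ℂ} (hν : 0 < ν.re) :
    Tendsto (besselMellin ν) (𝓝[>] 0) (𝓝 (Complex.Gamma ν)) := by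
  rw [Complex.Gamma_eq_integral hν]
  have : Complex.GammaIntegral ν = ∫ t in Ioi (0 : ℝ), (t : ℂ) ^ (ν - 1) • besselKernel 0 t := by
    refine setIntegral_congr_fun measurableSet_Ioi fun t _ => ?_
    simp [besselKernel, mul_comm]
  rw [this]
  refine tendsto_integral_filter_of_dominated_convergence
    (fun t => ‖((-t).exp : ℂ) * (t : ℂ) ^ (ν - 1)‖) ?_ ?_
    (Complex.GammaIntegral_convergent hν).norm ?_
  · filter_upwards [self_mem_nhdsWithin] with y hy
    exact (besselKernel_mellinConvergent hy ν).aestronglyMeasurable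
  · filter_upwards [self_mem_nhdsWithin] with y hy
    have hy : 0 < y := hy
    refine (ae_restrict_iff' measurableSet_Ioi).2 (.of_forall fun t ht => ?_)
    have ht : 0 < t := ht
    rw [norm_smul, norm_besselKernel, norm_mul, mul_comm, Complex.norm_real,
      Real.norm_eq_abs, Real.abs_exp]
    have : 0 < y / t := by positivity
    gcongr
    linarith
  · refine .of_forall fun t => ?_
    refine Tendsto.const_smul (tendsto_nhdsWithin_of_tendsto_nhds ?_) _
    have : Continuous fun y => besselKernel y t := by unfold besselKernel; fun_prop
    exact this.tendsto 0

/-! ### The power series of I_μ and its bilinear relations with J_ν. -/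

/-- The entire function `∑ y^n / (n! Γ(n + 1 + μ))`. -/
noncomputable def besselSeries (μ y : ℂ) : ℂ :=
  ∑' n : ℕ, y ^ n / (n.factorial * Complex.Gamma (n + 1 + μ))

/-- From 1/Γ(z) = z/Γ(z+1) with |n+1+μ| ≥ 1 for n ≥ ‖μ‖, the norms are eventually nonincreasing, so
finitely many of them bound all. -/
lemma exists_norm_inv_Gamma_le (μ : ℂ) :
    ∃ B : ℝ, ∀ n : ℕ, ‖(Complex.Gamma (n + 1 + μ))⁻¹‖ ≤ B := by
  obtain ⟨N, hN⟩ := exists_nat_ge ‖μ‖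
  have hstep : ∀ n : ℕ, N ≤ n → ‖(Complex.Gamma ((n + 1 : ℕ) + 1 + μ))⁻¹‖
      ≤ ‖(Complex.Gamma (n + 1 + μ))⁻¹‖ := by
    intro n hn
    rw [Complex.one_div_Gamma_eq_self_mul_one_div_Gamma_add_one (n + 1 + μ), norm_mul]
    have h1 : (1 : ℝ) ≤ ‖(n + 1 + μ : ℂ)‖ := by
      have h2 : ‖(n + 1 : ℂ)‖ ≤ ‖(n + 1 + μ : ℂ)‖ + ‖μ‖ := by
        simpa using norm_sub_le (n + 1 + μ : ℂ) μ
      have h3 : ‖(n + 1 : ℂ)‖ = n + 1 := by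
        exact_mod_cast Complex.norm_natCast (n + 1)
      have : (N : ℝ) ≤ n := by exact_mod_cast hn
      linarith
    have e : ((n + 1 : ℕ) + 1 + μ : ℂ) = n + 1 + μ + 1 := by push_cast; ring
    rw [e]
    exact le_mul_of_one_le_left (norm_nonneg _) h1
  refine ⟨∑ n ∈ Finset.range (N + 1), ‖(Complex.Gamma (n + 1 + μ))⁻¹‖, fun n => ?_⟩
  rcases le_or_gt n N with h | h
  · exact Finset.single_le_sum (f := fun n : ℕ => ‖(Complex.Gamma (n + 1 + μ))⁻¹‖)
      (fun _ _ => norm_nonneg _) (Finset.mem_range.2 (by omega))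
  · refine le_trans ?_ (Finset.single_le_sum (f := fun n : ℕ => ‖(Complex.Gamma (n + 1 + μ))⁻¹‖)
      (fun _ _ => norm_nonneg _) (Finset.self_mem_range_succ N))
    induction n, h.le using Nat.le_induction with
    | base => rfl
    | succ n hn ih =>
      rcases hn.eq_or_lt with rfl | h'
      · exact hstep _ le_rfl
      · exact (hstep n hn).trans (ih h')

lemma summable_besselSeries (μ y : ℂ) :
    Summable fun n : ℕ => y ^ n / (n.factorial * Complex.Gamma (n + 1 + μ)) := by
  obtain ⟨B, hB⟩ := exists_norm_inv_Gamma_le μ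
  refine Summable.of_norm_bounded ((Real.summable_pow_div_factorial ‖y‖).mul_right B) fun n => ?_
  rw [← div_div, div_eq_mul_inv _ (Complex.Gamma _), norm_mul, norm_div, norm_pow,
    Complex.norm_natCast]
  exact mul_le_mul_of_nonneg_left (hB n) (by positivity)

lemma hasSum_besselSeries_add_one (μ y : ℂ) :
    HasSum (fun n : ℕ => n * y ^ (n - 1) / (n.factorial * Complex.Gamma (n + 1 + μ)))
      (besselSeries (μ + 1) y) := by
  rw [← hasSum_nat_add_iff' 1]
  simp only [Finset.range_one, Finset.sum_singleton, Nat.cast_zero, zero_mul, zero_div, sub_zero]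
  refine (summable_besselSeries (μ + 1) y).hasSum.congr_fun fun n => ?_
  rw [Nat.factorial_succ, Nat.add_sub_cancel]
  have h : ((n + 1 : ℕ) : ℂ) ≠ 0 := Nat.cast_ne_zero.2 n.succ_ne_zero
  have e : ((n + 1 : ℕ) + 1 + μ : ℂ) = n + 1 + (μ + 1) := by push_cast; ring
  rw [e]
  push_cast at h ⊢
  rw [mul_assoc, mul_div_mul_left _ _ h]

lemma besselSeries_sub_one (μ y : ℂ) :
    besselSeries (μ - 1) y = μ * besselSeries μ y + y * besselSeries (μ + 1) y := by
  refine HasSum.tsum_eq ?_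
  refine (((summable_besselSeries μ y).hasSum.mul_left μ).add
    ((hasSum_besselSeries_add_one μ y).mul_left y)).congr_fun fun n => ?_
  have e1 : (n + 1 + (μ - 1) : ℂ) = n + μ := by ring
  have e2 : (n + μ + 1 : ℂ) = n + 1 + μ := by ring
  -- The relation 1/Γ(z) = z/Γ(z+1) also holds at the poles of Γ, with the value 0 for 1/Γ, so no
  -- condition on μ is needed.
  rw [e1, ← div_div, div_eq_mul_inv _ (Complex.Gamma _),
    Complex.one_div_Gamma_eq_self_mul_one_div_Gamma_add_one (n + μ), e2]
  rcases n with _ | n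
  · simp [div_eq_mul_inv]
  · rw [Nat.add_sub_cancel, pow_succ]
    field_simp
    ring

lemma hasDerivAt_besselSeries (μ y : ℂ) :
    HasDerivAt (besselSeries μ) (besselSeries (μ + 1) y) y := by
  obtain ⟨B, hB⟩ := exists_norm_inv_Gamma_le μ
  have hR : ∀ n : ℕ, ∀ z ∈ Metric.ball (0 : ℂ) (‖y‖ + 1),
      ‖n * z ^ (n - 1) / (n.factorial * Complex.Gamma (n + 1 + μ))‖ ≤
        n * (‖y‖ + 1) ^ (n - 1) / n.factorial * B := by
    intro n z hz
    rw [mem_ball_zero_iff] at hz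
    rw [← div_div, div_eq_mul_inv _ (Complex.Gamma _), norm_mul, norm_div, norm_mul, norm_pow,
      Complex.norm_natCast, Complex.norm_natCast]
    gcongr
    exact hB n
  have hsum : Summable fun n : ℕ => n * (‖y‖ + 1) ^ (n - 1) / n.factorial * B := by
    refine Summable.mul_right B ?_
    rw [← summable_nat_add_iff 1]
    refine (Real.summable_pow_div_factorial (‖y‖ + 1)).congr fun n => ?_
    rw [Nat.factorial_succ, Nat.add_sub_cancel]
    have h : ((n + 1 : ℕ) : ℝ) ≠ 0 := Nat.cast_ne_zero.2 n.succ_ne_zero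
    push_cast at h ⊢
    rw [mul_div_mul_left _ _ h]
  have := hasDerivAt_tsum_of_isPreconnected (y := y) hsum Metric.isOpen_ball
    (convex_ball (0 : ℂ) (‖y‖ + 1)).isPreconnected
    (fun n z _ => (hasDerivAt_pow n z).div_const (n.factorial * Complex.Gamma (n + 1 + μ))) hR
    (Metric.mem_ball_self (by positivity)) (summable_besselSeries μ 0)
    (by rw [mem_ball_zero_iff]; linarith)
  rwa [(hasSum_besselSeries_add_one μ y).tsum_eq] at this

lemma besselSeries_zero (μ : ℂ) : besselSeries μ 0 = (Complex.Gamma (1 + μ))⁻¹ := by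
  rw [besselSeries, tsum_eq_single 0 fun n hn => by simp [hn]]
  simp

/-- A Wronskian of I_ν and I_{-ν}: the contiguity relations make its derivative vanish, and at y = 0
it equals 1/(Γ(ν)Γ(1-ν)), which the reflection formula evaluates. -/
lemma besselSeries_cross (ν y : ℂ) :
    besselSeries (ν - 1) y * besselSeries (-ν) y - y * besselSeries ν y * besselSeries (1 - ν) y =
      Complex.sin (Real.pi * ν) / Real.pi := by
  have hd : ∀ z : ℂ, HasDerivAt (fun z => besselSeries (ν - 1) z * besselSeries (-ν) z -
      z * besselSeries ν z * besselSeries (1 - ν) z) 0 z := by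
    intro z
    have h1 := hasDerivAt_besselSeries (ν - 1) z
    have h2 := hasDerivAt_besselSeries (-ν) z
    have h3 := hasDerivAt_besselSeries ν z
    have h4 := hasDerivAt_besselSeries (1 - ν) z
    refine ((h1.mul h2).sub (((hasDerivAt_id z).mul h3).mul h4)).congr_deriv ?_
    have r1 := besselSeries_sub_one ν z
    have r2 := besselSeries_sub_one (1 - ν) z
    simp only [sub_add_cancel, id, Pi.mul_apply, show 1 - ν - 1 = -ν by ring, show -ν + 1 = 1 - ν by ring] at *
    linear_combination (besselSeries (1 - ν) z) * r1 + (besselSeries ν z) * r2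
  have hconst := is_const_of_deriv_eq_zero (fun z => (hd z).differentiableAt)
    (fun z => (hd z).deriv) y 0
  rw [hconst, besselSeries_zero, besselSeries_zero]
  simp only [zero_mul, sub_zero, add_sub_cancel, ← sub_eq_add_neg]
  rw [← mul_inv, Complex.Gamma_mul_Gamma_one_sub, inv_div]

/-- The analogous Wronskian of K_ν and I_ν; its derivative cancels by the relations for J and for
the series. -/
lemma besselMellin_cross_const (ν : ℂ) : ∃ c : ℂ, ∀ y : ℝ, 0 < y →
    besselMellin ν y * besselSeries (ν - 1) y + y * besselSeries ν y * besselMellin (ν - 1) y =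
      c := by
  have hd : ∀ z ∈ Ioi (0 : ℝ), HasDerivAt (fun y : ℝ => besselMellin ν y * besselSeries (ν - 1) y +
      y * besselSeries ν y * besselMellin (ν - 1) y) 0 z := by
    intro z hz
    have h1 := (hasDerivAt_besselSeries (ν - 1) z).comp_ofReal
    have h2 := (hasDerivAt_besselSeries ν z).comp_ofReal
    have h3 := besselMellin_hasDerivAt ν hz
    have h4 := besselMellin_hasDerivAt (ν - 1) hz
    refine ((h3.mul h1).add (((hasDerivAt_id z).ofReal_comp.mul h2).mul h4)).congr_deriv ?_
    have r1 := besselSeries_sub_one ν z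
    have r2 := besselMellin_add_one hz (ν - 1)
    simp only [sub_add_cancel, id, Pi.mul_apply, Complex.ofReal_one, one_mul] at *
    linear_combination (besselSeries ν z) * r2 - (besselMellin (ν - 1) z) * r1
  exact isOpen_Ioi.exists_is_const_of_deriv_eq_zero isPreconnected_Ioi
    (fun z hz => (hd z hz).differentiableAt.differentiableWithinAt) (fun z hz => (hd z hz).deriv)

lemma besselMellin_cross_of_re_pos {ν : ℂ} (hν : 0 < ν.re) {y : ℝ} (hy : 0 < y) :
    besselMellin ν y * besselSeries (ν - 1) y + y * besselSeries ν y * besselMellin (ν - 1) y =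
      1 := by
  obtain ⟨c, hc⟩ := besselMellin_cross_const ν
  rw [hc y hy]
  have hS : ∀ μ : ℂ, Tendsto (fun y : ℝ => besselSeries μ y) (𝓝[>] 0)
      (𝓝 (Complex.Gamma (1 + μ))⁻¹) := by
    intro μ
    have := (hasDerivAt_besselSeries μ (0 : ℝ)).comp_ofReal.continuousAt.tendsto
    rw [Complex.ofReal_zero, besselSeries_zero] at this
    exact tendsto_nhdsWithin_of_tendsto_nhds this
  have hJ := tendsto_besselMellin_zero hν
  -- J_{ν-1} may itself be unbounded near 0, but y·J_{ν-1} = J_{ν+1} - ν·J_ν tends to Γ(ν+1) - νΓ(ν)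
  -- = 0.
  have hJ' : Tendsto (fun y : ℝ => y * besselMellin (ν - 1) y) (𝓝[>] 0) (𝓝 0) := by
    have h1 := (tendsto_besselMellin_zero (ν := ν + 1) (by simp; linarith)).sub (hJ.const_mul ν)
    have hν0 : ν ≠ 0 := by rintro rfl; simp at hν
    rw [Complex.Gamma_add_one _ hν0, sub_self] at h1
    refine h1.congr' ?_
    filter_upwards [self_mem_nhdsWithin] with z hz
    rw [besselMellin_add_one hz]
    ring
  have hlim := (hJ.mul (hS (ν - 1))).add ((hS ν).mul hJ')
  rw [add_sub_cancel, mul_zero, add_zero, mul_inv_cancel₀ (Complex.Gamma_ne_zero_of_re_pos hν)]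
    at hlim
  refine tendsto_nhds_unique (tendsto_const_nhds.congr' ?_) hlim
  filter_upwards [self_mem_nhdsWithin] with z hz
  rw [← hc z hz]
  ring

/-- The two contiguity relations show that the expression is unchanged under ν ↦ ν+1, so the value
found for Re ν > 0 propagates to every ν. -/
lemma besselMellin_cross (ν : ℂ) {y : ℝ} (hy : 0 < y) :
    besselMellin ν y * besselSeries (ν - 1) y + y * besselSeries ν y * besselMellin (ν - 1) y =
      1 := by
  have hstep : ∀ n : ℕ, ∀ μ : ℂ, -(n : ℝ) < μ.re → besselMellin μ y * besselSeries (μ - 1) y +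
      y * besselSeries μ y * besselMellin (μ - 1) y = 1 := by
    intro n
    induction n with
    | zero => exact fun μ h => besselMellin_cross_of_re_pos (by simpa using h) hy
    | succ n ih =>
      intro μ h
      have h1 := ih (μ + 1) (by push_cast at h; simp; linarith)
      rw [add_sub_cancel_right, besselMellin_add_one hy] at h1
      rw [besselSeries_sub_one]
      linear_combination h1
  obtain ⟨n, hn⟩ := exists_nat_gt (-ν.re)
  exact hstep n ν (by linarith)

/-- The bilinear relation at ν and at 1-ν, with the inversion formula linking J_ν to J_{-ν} and
J_{ν-1} to J_{1-ν}, is a linear system for J_ν whose determinant is the Wronskian sin(πν)/π. -/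
lemma besselMellin_mul_sin (ν : ℂ) {y : ℝ} (hy : 0 < y) :
    besselMellin ν y * (Complex.sin (Real.pi * ν) / Real.pi) =
      besselSeries (-ν) y - (y : ℂ) ^ ν * besselSeries ν y := by
  have hy0 : (y : ℂ) ≠ 0 := by exact_mod_cast hy.ne'
  have h1 := besselMellin_cross ν hy
  have h2 := besselMellin_cross (1 - ν) hy
  have h3 := besselMellin_eq_cpow_mul hy (ν - 1)
  have h4 := besselMellin_eq_cpow_mul hy ν
  have h5 : (y : ℂ) ^ ν = y * (y : ℂ) ^ (ν - 1) := by
    rw [Complex.cpow_sub _ _ hy0, Complex.cpow_one]; field_simp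
  rw [show 1 - ν - 1 = -ν by ring] at h2
  rw [neg_sub] at h3
  rw [← besselSeries_cross ν y]
  linear_combination (besselSeries (-ν) y) * h1 - (y : ℂ) ^ ν * besselSeries ν y * h2 -
    y * besselSeries ν y * besselSeries (-ν) y * h3 -
    y * besselSeries ν y * besselSeries (1 - ν) y * h4 +
    besselSeries ν y * besselSeries (-ν) y * besselMellin (1 - ν) y * h5

/-! ### The integral representation of K_ν. -/

lemma besselI_two_mul (μ : ℂ) {w : ℝ} (hw : 0 < w) :
    besselI μ ((2 * w : ℝ) : ℂ) = (w : ℂ) ^ μ * besselSeries μ ((w ^ 2 : ℝ) : ℂ) := by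
  have hw0 : (w : ℂ) ≠ 0 := by exact_mod_cast hw.ne'
  rw [besselI, besselSeries, ← tsum_mul_left]
  refine tsum_congr fun n => ?_
  have e : ((2 * w : ℝ) : ℂ) / 2 = w := by push_cast; ring
  rw [e, Complex.cpow_add _ _ hw0, mul_div_assoc, add_comm μ, add_right_comm]
  congr 2
  rw [show (2 * (n : ℂ)) = ((2 * n : ℕ) : ℂ) by push_cast; ring, Complex.cpow_natCast, pow_mul]
  push_cast
  rfl

lemma besselKAux_two_mul {ν : ℂ} (hν : ¬ ∃ m : ℤ, ν = m) {w : ℝ} (hw : 0 < w) :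
    besselKAux ν ((2 * w : ℝ) : ℂ) = (w : ℂ) ^ (-ν) * besselMellin ν (w ^ 2) / 2 := by
  have hpi : (Real.pi : ℂ) ≠ 0 := by exact_mod_cast Real.pi_ne_zero
  have hw0 : (w : ℂ) ≠ 0 := by exact_mod_cast hw.ne'
  have hsin : Complex.sin (Real.pi * ν) ≠ 0 := by
    rw [Ne, Complex.sin_eq_zero_iff]
    rintro ⟨m, hm⟩
    refine hν ⟨m, mul_left_cancel₀ hpi ?_⟩
    rw [hm, mul_comm]
  have h := besselMellin_mul_sin ν (pow_pos hw 2)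
  have hp : ((w ^ 2 : ℝ) : ℂ) ^ ν = (w : ℂ) ^ ν * (w : ℂ) ^ ν := by
    rw [sq, Complex.ofReal_mul, Complex.mul_cpow_ofReal_nonneg hw.le hw.le]
  have hn : (w : ℂ) ^ (-ν) * (w : ℂ) ^ ν = 1 := by
    rw [← Complex.cpow_add _ _ hw0]; simp
  rw [besselKAux, besselI_two_mul _ hw, besselI_two_mul _ hw]
  rw [hp] at h
  field_simp at h ⊢
  linear_combination (-(w : ℂ) ^ (-ν)) * h + (Real.pi * (w : ℂ) ^ ν *
    besselSeries ν ((w ^ 2 : ℝ) : ℂ)) * hn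

/-- For integral ν, K_ν is a limit in the order, and the right side is continuous in ν because J_ν
is differentiable in ν. -/
theorem besselK_two_mul (ν : ℂ) {w : ℝ} (hw : 0 < w) :
    besselK ν ((2 * w : ℝ) : ℂ) = (w : ℂ) ^ (-ν) * besselMellin ν (w ^ 2) / 2 := by
  rw [besselK]
  split_ifs with hν
  · obtain ⟨m, rfl⟩ := hν
    refine Tendsto.limUnder_eq ?_
    have hw0 : (w : ℂ) ≠ 0 := by exact_mod_cast hw.ne'
    have hc : ContinuousAt (fun μ : ℂ => (w : ℂ) ^ (-μ) * besselMellin μ (w ^ 2) / 2) m :=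
      (((continuousAt_const_cpow hw0).comp continuousAt_neg).mul
        (differentiableAt_besselMellin (pow_pos hw 2) _).continuousAt).div_const 2
    refine (hc.tendsto.mono_left nhdsWithin_le_nhds).congr' ?_
    -- The punctured unit ball about m contains no integer, so the formula for nonintegral order
    -- applies throughout it.
    have hball : Metric.ball (m : ℂ) 1 ∈ 𝓝[≠] (m : ℂ) :=
      mem_nhdsWithin_of_mem_nhds (Metric.ball_mem_nhds _ one_pos)
    filter_upwards [hball, self_mem_nhdsWithin] with μ hμ hne
    refine (besselKAux_two_mul ?_ hw).symm
    rintro ⟨l, rfl⟩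
    rw [Metric.mem_ball, dist_eq_norm, ← Int.cast_sub, Complex.norm_intCast] at hμ
    have : |l - m| < 1 := by exact_mod_cast hμ
    rw [Int.abs_lt_one_iff, sub_eq_zero] at this
    exact hne (by simp [this])
  · exact besselKAux_two_mul hν hw

/-! ### The Hurwitz difference ζ(s,θ) - ζ(s,1-θ) for Re s > 0 and at s = 0. -/

lemma norm_cpow_neg_sub_cpow_neg_le {s : ℂ} (hs : -1 ≤ s.re) {c x y : ℝ} (hc : 0 < c)
    (hx : c ≤ x) (hy : c ≤ y) :
    ‖(x : ℂ) ^ (-s) - (y : ℂ) ^ (-s)‖ ≤ ‖s‖ * c ^ (-s.re - 1) * |x - y| := by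
  rcases eq_or_ne s 0 with rfl | h0
  · simp
  refine (convex_Ici c).norm_image_sub_le_of_norm_hasDerivWithin_le
    (f := fun u : ℝ => (u : ℂ) ^ (-s)) (f' := fun u : ℝ => -s * (u : ℂ) ^ (-s - 1))
    (fun u hu => ?_) (fun u hu => ?_) hy hx
  · exact (hasDerivAt_ofReal_cpow_const (hc.trans_le hu).ne' (neg_ne_zero.2 h0)).hasDerivWithinAt
  · have hu' : 0 < u := hc.trans_le hu
    rw [norm_mul, norm_neg, Complex.norm_cpow_eq_rpow_re_of_pos hu']
    refine mul_le_mul_of_nonneg_left ?_ (norm_nonneg _)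
    simpa using Real.rpow_le_rpow_of_nonpos hc hu (by linarith : -s.re - 1 ≤ 0)

lemma hurwitzDiff_one_sub (θ : ℝ) (s : ℂ) : hurwitzDiff (1 - θ) s = -hurwitzDiff θ s := by
  rw [hurwitzDiff, hurwitzDiff, sub_sub_cancel, neg_sub]

/-- By the mean value inequality, pairing the terms gains a power of n, so the series converges
locally uniformly for Re s > 0. The identity theorem carries the formula over from Re s > 1. -/
lemma hasSum_hurwitzDiff {θ : ℝ} (h0 : 0 < θ) (h1 : θ < 1) {s : ℂ} (hs : 0 < s.re) :
    HasSum (fun n : ℕ => ((n + θ : ℝ) : ℂ) ^ (-s) - ((n + 1 - θ : ℝ) : ℂ) ^ (-s))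
      (hurwitzDiff θ s) := by
  set δ : ℝ := min θ (1 - θ) with hδdef
  have hδ : 0 < δ := lt_min h0 (by linarith)
  have hδ1 : δ ≤ 1 := (min_le_left _ _).trans h1.le
  obtain ⟨σ, hσ, hσm⟩ := exists_between (lt_min hs two_pos)
  have hσs : σ < s.re := hσm.trans_le (min_le_left _ _)
  have hσ2 : σ < 2 := hσm.trans_le (min_le_right _ _)
  set R : ℝ := ‖s‖ + 3 with hRdef
  -- The mean value bound carries a factor ‖z‖, so the half-plane is cut to a convex bounded region,
  -- large enough to contain both s and the base point 2.
  set U : Set ℂ := {z | σ < z.re} ∩ Metric.ball 0 R with hU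
  have hUo : IsOpen U := (isOpen_lt continuous_const Complex.continuous_re).inter Metric.isOpen_ball
  have hUc : IsPreconnected U :=
    ((convex_halfSpace_re_gt σ).inter (convex_ball 0 R)).isPreconnected
  set F : ℕ → ℂ → ℂ := fun n z => ((n + θ : ℝ) : ℂ) ^ (-z) - ((n + 1 - θ : ℝ) : ℂ) ^ (-z) with hF
  -- The factor δ^(σ-R) makes the bound uniform in Re z even when n + δ < 1, which can happen at n =
  -- 0.
  set u : ℕ → ℝ := fun n => R * δ ^ (σ - R) * (n + δ) ^ (-σ - 1) with hu
  have hle : ∀ n : ℕ, ∀ z ∈ U, ‖F n z‖ ≤ u n := by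
    rintro n z ⟨hz1, hz2⟩
    have hz1 : σ < z.re := hz1
    rw [mem_ball_zero_iff] at hz2
    have hc : 0 < (n : ℝ) + δ := by positivity
    have hn : (1 : ℝ) ≤ (n + δ) / δ := by
      rw [le_div_iff₀ hδ]; linarith [(Nat.cast_nonneg n : (0 : ℝ) ≤ n)]
    have hzre : z.re ≤ R := (Complex.re_le_norm z).trans hz2.le
    have hb := norm_cpow_neg_sub_cpow_neg_le (s := z) (by linarith) hc
      (x := n + θ) (y := n + 1 - θ) (by linarith [min_le_left θ (1 - θ)])
      (by linarith [min_le_right θ (1 - θ)])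
    have habs : |(n + θ : ℝ) - (n + 1 - θ)| ≤ 1 := by rw [abs_le]; constructor <;> linarith
    calc ‖F n z‖ ≤ ‖z‖ * (n + δ) ^ (-z.re - 1) * 1 := hb.trans (by gcongr)
      _ = ‖z‖ * (δ ^ (σ - z.re) * ((n + δ) / δ) ^ (σ - z.re) * (n + δ) ^ (-σ - 1)) := by
        rw [Real.div_rpow hc.le hδ.le, mul_div_cancel₀ _ (by positivity), ← Real.rpow_add hc]
        ring_nf
      _ ≤ R * (δ ^ (σ - R) * 1 * (n + δ) ^ (-σ - 1)) := by
        have e1 := Real.rpow_le_rpow_of_exponent_ge hδ hδ1 (by linarith : σ - R ≤ σ - z.re)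
        have e2 := Real.rpow_le_one_of_one_le_of_nonpos hn (by linarith : σ - z.re ≤ 0)
        have hR0 : 0 ≤ R := by positivity
        gcongr
      _ = u n := by rw [hu]; ring
  have husum : Summable u := by
    refine Summable.mul_left _ ?_
    refine ((Real.summable_one_div_nat_add_rpow δ (σ + 1)).2 (by linarith)).congr fun n => ?_
    rw [abs_of_pos (by positivity), one_div, ← Real.rpow_neg (by positivity), neg_add, sub_eq_add_neg]
  have hFd : ∀ n, DifferentiableOn ℂ (F n) U := by
    intro n z _
    have hp : ((n + θ : ℝ) : ℂ) ≠ 0 := by exact_mod_cast (by positivity : (n + θ : ℝ) ≠ 0)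
    have hq : ((n + 1 - θ : ℝ) : ℂ) ≠ 0 := by
      have : (0 : ℝ) < n + 1 - θ := by linarith [(Nat.cast_nonneg n : (0 : ℝ) ≤ n)]
      exact_mod_cast this.ne'
    exact ((differentiableAt_id.neg.const_cpow (.inl hp)).sub
      (differentiableAt_id.neg.const_cpow (.inl hq))).differentiableWithinAt
  have hdiff : DifferentiableOn ℂ (fun z => ∑' n, F n z) U :=
    Complex.differentiableOn_tsum_of_summable_norm husum hFd hUo hle
  have hZ : DifferentiableOn ℂ (hurwitzDiff θ) U :=
    (differentiable_hurwitzZeta_sub_hurwitzZeta _ _).differentiableOn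
  have h2U : (2 : ℂ) ∈ U := by
    refine ⟨by simpa using hσ2, ?_⟩
    rw [mem_ball_zero_iff]
    norm_num
    linarith [norm_nonneg s]
  have hsU : s ∈ U := ⟨hσs, by rw [mem_ball_zero_iff]; linarith⟩
  have heq : EqOn (fun z => ∑' n, F n z) (hurwitzDiff θ) U := by
    refine (hdiff.analyticOnNhd hUo).eqOn_of_preconnected_of_eventuallyEq
      (hZ.analyticOnNhd hUo) hUc h2U ?_
    filter_upwards [(isOpen_lt continuous_const Complex.continuous_re).mem_nhds
      (show (2 : ℂ) ∈ {z : ℂ | 1 < z.re} by simp)] with z hz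
    have ha := hasSum_hurwitzZeta_of_one_lt_re (a := θ) ⟨h0.le, h1.le⟩ hz
    have hb := hasSum_hurwitzZeta_of_one_lt_re (a := 1 - θ) ⟨by linarith, by linarith⟩ hz
    refine ((ha.sub hb).congr_fun fun n => ?_).tsum_eq
    simp only [hF, Complex.cpow_neg, one_div]
    push_cast
    ring_nf
  rw [← heq hsU]
  exact (Summable.of_norm_bounded husum fun n => hle n s hsU).hasSum

lemma hasSum_hurwitzDiff_nat {θ : ℝ} (h0 : 0 < θ) (h1 : θ < 1) (k : ℕ) :
    HasSum (fun n : ℕ => 1 / ((n : ℂ) + θ) ^ (k + 1) - 1 / ((n : ℂ) + 1 - θ) ^ (k + 1))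
      (hurwitzDiff θ (1 + k)) := by
  refine (hasSum_hurwitzDiff h0 h1 (s := 1 + k) (by simp; positivity)).congr_fun fun n => ?_
  have e : (1 + k : ℂ) = ((k + 1 : ℕ) : ℂ) := by push_cast; ring
  rw [e, Complex.cpow_neg, Complex.cpow_neg, Complex.cpow_natCast, Complex.cpow_natCast]
  push_cast
  simp only [one_div]

/-- For s > 0 the mean value theorem traps each paired term between (1-2θ)·s·(n+1-θ)^(-s-1) and
(1-2θ)·s·(n+θ)^(-s-1). The sums of these bounds are (1-2θ)·s·ζ(1+s,·), and both tend to 1-2θ by the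
residue at the pole. The case θ ≥ 1/2 follows by the symmetry θ ↦ 1-θ. -/
lemma hurwitzDiff_zero_of_le_half {θ : ℝ} (h0 : 0 < θ) (h1 : θ ≤ 1 / 2) :
    hurwitzDiff θ 0 = 1 - 2 * θ := by
  have hres : ∀ a : ℝ, Tendsto (fun s : ℝ => (s * hurwitzZeta (a : UnitAddCircle) (1 + s)).re)
      (𝓝[>] 0) (𝓝 1) := by
    intro a
    have h := hurwitzZeta_residue_one (a : UnitAddCircle)
    have hg : Tendsto (fun s : ℝ => (1 + s : ℂ)) (𝓝[>] 0) (𝓝[≠] 1) := by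
      refine tendsto_nhdsWithin_iff.2 ⟨?_, ?_⟩
      · refine tendsto_nhdsWithin_of_tendsto_nhds ?_
        have : Continuous fun s : ℝ => (1 + s : ℂ) := by fun_prop
        simpa using this.tendsto 0
      · filter_upwards [self_mem_nhdsWithin] with s hs
        have hs : s ≠ 0 := (mem_Ioi.1 hs).ne'
        simpa using hs
    have := (Complex.continuous_re.tendsto 1).comp (h.comp hg)
    simpa [Function.comp_def] using this
  have hD : Tendsto (fun s : ℝ => hurwitzDiff θ s) (𝓝[>] 0) (𝓝 (hurwitzDiff θ 0)) := by
    have hc : Continuous (hurwitzDiff θ) :=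
      (differentiable_hurwitzZeta_sub_hurwitzZeta _ _).continuous
    refine tendsto_nhdsWithin_of_tendsto_nhds ?_
    simpa [Function.comp_def] using (hc.comp Complex.continuous_ofReal).tendsto 0
  have hterm : ∀ s : ℝ, 0 < s → ∀ n : ℕ,
      (((n + θ : ℝ) : ℂ) ^ (-(s : ℂ)) - ((n + 1 - θ : ℝ) : ℂ) ^ (-(s : ℂ))) =
        (((n + θ : ℝ) ^ (-s) - (n + 1 - θ : ℝ) ^ (-s) : ℝ) : ℂ) := by
    intro s hs n
    have hp : (0 : ℝ) ≤ n + 1 - θ := by linarith [(Nat.cast_nonneg n : (0 : ℝ) ≤ n)]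
    rw [Complex.ofReal_sub ((n + θ : ℝ) ^ (-s)), Complex.ofReal_cpow (by positivity),
      Complex.ofReal_cpow hp, Complex.ofReal_neg]
  have hreal : ∀ s : ℝ, 0 < s → HasSum (fun n : ℕ => (n + θ : ℝ) ^ (-s) - (n + 1 - θ : ℝ) ^ (-s))
      (hurwitzDiff θ s).re ∧ (hurwitzDiff θ s).im = 0 := by
    intro s hs
    have h := hasSum_hurwitzDiff h0 (by linarith) (s := s) (by simpa using hs)
    refine ⟨?_, ?_⟩
    · refine (Complex.hasSum_re h).congr_fun fun n => ?_
      rw [hterm s hs, Complex.ofReal_re]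
    · refine (Complex.hasSum_im h).unique (hasSum_zero.congr_fun fun n => ?_)
      rw [hterm s hs, Complex.ofReal_im]
  have hzeta : ∀ a : ℝ, 0 < a → a ≤ 1 → ∀ s : ℝ, 0 < s →
      HasSum (fun n : ℕ => (1 - 2 * θ) * (s * (n + a : ℝ) ^ (-s - 1)))
        ((1 - 2 * θ) * (s * hurwitzZeta (a : UnitAddCircle) (1 + s)).re) := by
    intro a ha ha1 s hs
    have h := hasSum_hurwitzZeta_of_one_lt_re (a := a) ⟨ha.le, ha1⟩ (s := 1 + s) (by simpa using hs)
    refine HasSum.mul_left _ ((Complex.hasSum_re (h.mul_left (s : ℂ))).congr_fun fun n => ?_)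
    have : (1 / ((n : ℂ) + a) ^ (1 + s : ℂ)) = (((n + a : ℝ) ^ (-s - 1) : ℝ) : ℂ) := by
      rw [Complex.ofReal_cpow (by positivity), one_div, ← Complex.cpow_neg]
      push_cast
      ring_nf
    rw [this, ← Complex.ofReal_mul, Complex.ofReal_re]
  have hmvt : ∀ s : ℝ, 0 < s → ∀ n : ℕ,
      (1 - 2 * θ) * (s * (n + (1 - θ) : ℝ) ^ (-s - 1)) ≤
        (n + θ : ℝ) ^ (-s) - (n + 1 - θ : ℝ) ^ (-s) ∧
      (n + θ : ℝ) ^ (-s) - (n + 1 - θ : ℝ) ^ (-s) ≤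
        (1 - 2 * θ) * (s * (n + θ : ℝ) ^ (-s - 1)) := by
    intro s hs n
    have hn : (0 : ℝ) ≤ n := Nat.cast_nonneg n
    have hd : ∀ v ∈ Icc (n + θ : ℝ) (n + 1 - θ),
        HasDerivAt (fun u : ℝ => u ^ (-s)) (-s * v ^ (-s - 1)) v := fun v hv =>
      Real.hasDerivAt_rpow_const (.inl (by linarith [hv.1]))
    rcases h1.eq_or_lt with rfl | hlt
    · norm_num
      ring_nf
      simp
    obtain ⟨v, hv, he⟩ := exists_hasDerivAt_eq_slope (fun u : ℝ => u ^ (-s))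
      (fun v => -s * v ^ (-s - 1)) (by linarith : (n + θ : ℝ) < n + 1 - θ)
      (fun v hv => (hd v hv).continuousAt.continuousWithinAt)
      (fun v hv => hd v (Ioo_subset_Icc_self hv))
    have hpos : (0 : ℝ) < n + 1 - θ - (n + θ) := by linarith
    rw [eq_div_iff hpos.ne'] at he
    have he' : (n + θ : ℝ) ^ (-s) - (n + 1 - θ : ℝ) ^ (-s) = (1 - 2 * θ) * (s * v ^ (-s - 1)) := by
      linear_combination he
    have hv0 : 0 < v := by linarith [hv.1]
    have hθ : 0 ≤ 1 - 2 * θ := by linarith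
    rw [he']
    constructor
    · refine mul_le_mul_of_nonneg_left (mul_le_mul_of_nonneg_left ?_ hs.le) hθ
      exact Real.rpow_le_rpow_of_nonpos hv0 (by linarith [hv.2]) (by linarith)
    · refine mul_le_mul_of_nonneg_left (mul_le_mul_of_nonneg_left ?_ hs.le) hθ
      exact Real.rpow_le_rpow_of_nonpos (by positivity) hv.1.le (by linarith)
  have hre : Tendsto (fun s : ℝ => (hurwitzDiff θ s).re) (𝓝[>] 0) (𝓝 ((1 - 2 * θ) * 1)) := by
    refine tendsto_of_tendsto_of_tendsto_of_le_of_le' ((hres (1 - θ)).const_mul (1 - 2 * θ))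
      ((hres θ).const_mul (1 - 2 * θ)) ?_ ?_
    · filter_upwards [self_mem_nhdsWithin] with s hs
      exact hasSum_le (fun n => (hmvt s hs n).1)
        (hzeta (1 - θ) (by linarith) (by linarith) s hs) (hreal s hs).1
    · filter_upwards [self_mem_nhdsWithin] with s hs
      exact hasSum_le (fun n => (hmvt s hs n).2) (hreal s hs).1 (hzeta θ h0 (by linarith) s hs)
  have him : Tendsto (fun s : ℝ => (hurwitzDiff θ s).im) (𝓝[>] 0) (𝓝 0) := by
    refine tendsto_const_nhds.congr' ?_
    filter_upwards [self_mem_nhdsWithin] with s hs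
    exact (hreal s hs).2.symm
  have hre' := tendsto_nhds_unique ((Complex.continuous_re.tendsto _).comp hD) hre
  have him' := tendsto_nhds_unique ((Complex.continuous_im.tendsto _).comp hD) him
  apply Complex.ext
  · rw [hre']; simp
  · rw [him']; simp

lemma hurwitzDiff_zero {θ : ℝ} (h0 : 0 < θ) (h1 : θ < 1) : hurwitzDiff θ 0 = 1 - 2 * θ := by
  rcases le_total θ (1 / 2) with h | h
  · exact hurwitzDiff_zero_of_le_half h0 h
  · have := hurwitzDiff_zero_of_le_half (θ := 1 - θ) (by linarith) (by linarith)
    rw [hurwitzDiff_one_sub] at this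
    push_cast at this
    linear_combination -this

/-! ### Lipschitz's formula. -/

/-- `∑_{d ≥ 1} d^k e^{2πidz}`. -/
noncomputable def qSeries (k : ℕ) (z : ℂ) : ℂ :=
  ∑' d : ℕ+, (d : ℂ) ^ k * Complex.exp (2 * Real.pi * Complex.I * z) ^ (d : ℕ)

/-- The factor `(-2πi)^(k+1) / k!` of the Lipschitz formula. -/
noncomputable def lipschitzConst (k : ℕ) : ℂ :=
  (-2 * Real.pi * Complex.I) ^ (k + 1) / k.factorial

lemma tsum_int_eq_zero_add_tsum_pnat_add {f : ℤ → ℂ} (hf : Summable f) :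
    ∑' n, f n = f 0 + ∑' n : ℕ+, (f n + f (-n)) := by
  have h1 : Summable fun n : ℕ+ => f n :=
    hf.comp_injective (Nat.cast_injective.comp PNat.coe_injective)
  have h2 : Summable fun n : ℕ+ => f (-n) :=
    hf.comp_injective (neg_injective.comp (Nat.cast_injective.comp PNat.coe_injective))
  rw [tsum_int_eq_zero_add_tsum_pnat hf, h1.tsum_add h2, add_assoc]

lemma lipschitz_cot {z : ℂ} (hz : 0 < z.im) :
    Real.pi * Complex.cot (Real.pi * z) = -Real.pi * Complex.I + lipschitzConst 0 * qSeries 0 z := by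
  have h := pi_mul_cot_pi_q_exp ⟨z, hz⟩
  have hs := summable_pow_mul_cexp 0 1 ⟨z, hz⟩
  simp only [pow_zero, one_mul, PNat.val_ofNat, Nat.cast_one, mul_one] at hs
  have h2 := tsum_zero_pnat_eq_tsum_nat hs
  simp only [pow_zero] at h h2
  rw [h, ← h2, lipschitzConst, qSeries]
  simp only [pow_zero, one_mul]
  simp
  ring

/-- Stated for linear combinations because at k = 0 a single sum ∑ 1/(z+n) does not converge
absolutely. The condition ∑c_i = 0 also cancels the constant -πi in the cotangent expansion. -/
lemma lipschitz_formula {ι : Type*} [Fintype ι] (c z : ι → ℂ) (hz : ∀ i, 0 < (z i).im) (k : ℕ)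
    (hk : k ≠ 0 ∨ ∑ i, c i = 0)
    (hsum : Summable fun n : ℤ => ∑ i, c i / (z i + n) ^ (k + 1)) :
    ∑' n : ℤ, ∑ i, c i / (z i + n) ^ (k + 1) = lipschitzConst k * ∑ i, c i * qSeries k (z i) := by
  rcases Nat.eq_zero_or_pos k with rfl | hk0
  · have hc : ∑ i, c i = 0 := hk.resolve_left (by simp)
    have hz' : ∀ i, z i ∈ Complex.integerComplement := fun i =>
      UpperHalfPlane.coe_mem_integerComplement ⟨z i, hz i⟩
    simp only [zero_add, pow_one] at hsum ⊢
    rw [tsum_int_eq_zero_add_tsum_pnat_add hsum]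
    have hs : ∀ i, Summable fun n : ℕ+ => 1 / (z i - n) + 1 / (z i + n) := fun i => by
      rw [summable_pnat_iff_summable_succ (f := fun n : ℕ => 1 / (z i - n) + 1 / (z i + n))]
      simpa [cotTerm] using! summable_cotTerm (hz' i)
    have hcot : ∀ i, ∑' n : ℕ+, (1 / (z i - n) + 1 / (z i + n)) =
        -Real.pi * Complex.I + lipschitzConst 0 * qSeries 0 (z i) - 1 / z i := fun i => by
      rw [← lipschitz_cot (hz i), cot_series_rep (hz' i)]
      ring
    have h1 : ∀ n : ℕ+, ∑ i, c i / (z i + ((n : ℤ) : ℂ)) + ∑ i, c i / (z i + ((-(n : ℤ) : ℤ) : ℂ)) =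
        ∑ i, c i * (1 / (z i - n) + 1 / (z i + n)) := fun n => by
      rw [← Finset.sum_add_distrib]
      refine Finset.sum_congr rfl fun i _ => ?_
      push_cast
      ring
    have h2 : ∑' n : ℕ+, (∑ i, c i / (z i + ((n : ℤ) : ℂ)) +
        ∑ i, c i / (z i + ((-(n : ℤ) : ℤ) : ℂ))) =
        ∑ i, c i * (-Real.pi * Complex.I + lipschitzConst 0 * qSeries 0 (z i) - 1 / z i) := by
      rw [tsum_congr h1, Summable.tsum_finsetSum fun i _ => (hs i).mul_left (c i)]
      simp only [tsum_mul_left, hcot]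
    rw [h2]
    simp only [mul_add, mul_sub, Finset.sum_add_distrib, Finset.sum_sub_distrib, ← Finset.sum_mul,
      hc, zero_mul, zero_add, Finset.mul_sum, Int.cast_zero, add_zero, mul_one_div]
    rw [add_sub_cancel]
    exact Finset.sum_congr rfl fun i _ => by ring
  · have hs : ∀ i, Summable fun n : ℤ => 1 / (z i + n) ^ (k + 1) := fun i => by
      have := EisensteinSeries.linear_right_summable (z i) 1 (k := (k + 1 : ℕ)) (by omega)
      simpa only [Int.cast_one, one_mul, zpow_natCast, one_div] using this
    have h1 : ∀ n : ℤ, ∑ i, c i / (z i + n) ^ (k + 1) = ∑ i, c i * (1 / (z i + n) ^ (k + 1)) :=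
      fun n => Finset.sum_congr rfl fun i _ => by ring
    rw [tsum_congr h1, Summable.tsum_finsetSum fun i _ => (hs i).mul_left (c i), Finset.mul_sum]
    refine Finset.sum_congr rfl fun i _ => ?_
    have := EisensteinSeries.qExpansion_identity_pnat hk0 ⟨z i, hz i⟩
    simp only at this
    rw [tsum_mul_left, this, lipschitzConst, qSeries]
    ring

/-! ### Absolute convergence of the double series along rows and columns. -/

lemma summable_pow_mul_exp_prod (k : ℕ) {A θ : ℝ} (hA : 0 < A) (hθ : 0 < θ) :
    Summable fun p : ℕ+ × ℕ => ((p.1 : ℕ) : ℝ) ^ k * Real.exp (-(A * p.1 * (p.2 + θ))) := by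
  set δ := min θ 1 with hδ
  have hδ0 : 0 < δ := lt_min hθ one_pos
  set r : ℝ := Real.exp (-(A * δ)) with hr
  have hr1 : ‖r‖ < 1 := by
    rw [Real.norm_eq_abs, Real.abs_exp, Real.exp_lt_one_iff]
    have := mul_pos hA hδ0
    linarith
  have h := summable_prod_mul_pow k hr1
  have h' : Summable fun p : ℕ+ × ℕ => ((p.1 : ℕ) : ℝ) ^ k * r ^ ((p.2 + 1) * p.1 : ℕ) := by
    let e : ℕ+ × ℕ ≃ ℕ+ × ℕ+ := (Equiv.prodCongr (Equiv.refl _) Equiv.pnatEquivNat.symm).trans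
      (Equiv.prodComm _ _)
    exact (e.summable_iff (f := fun c : ℕ+ × ℕ+ => ((c.2 : ℕ) : ℝ) ^ k * r ^ (c.1 * c.2 : ℕ))).2 h
  refine Summable.of_nonneg_of_le (fun p => by positivity) (fun p => ?_) h'
  refine mul_le_mul_of_nonneg_left ?_ (by positivity)
  rw [hr, ← Real.exp_nat_mul, Real.exp_le_exp]
  push_cast
  -- With δ = min(θ, 1) the shift j + θ is comparable to j + 1, which reduces the series to ∑ d^k
  -- r^(jd) over positive d and j.
  have h1 : δ * (p.2 + 1) ≤ p.2 + θ := by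
    have h2 : δ * p.2 ≤ 1 * p.2 := mul_le_mul_of_nonneg_right (min_le_right _ _) (Nat.cast_nonneg _)
    linarith [min_le_left θ 1]
  have h3 : (0 : ℝ) ≤ A * (p.1 : ℕ) := by positivity
  nlinarith [mul_le_mul_of_nonneg_left h1 h3]

lemma norm_qSeries_term (k : ℕ) (z : ℂ) (d : ℕ) :
    ‖(d : ℂ) ^ k * Complex.exp (2 * Real.pi * Complex.I * z) ^ d‖ =
      (d : ℝ) ^ k * Real.exp (-(2 * Real.pi * z.im * d)) := by
  rw [norm_mul, norm_pow, Complex.norm_natCast, norm_pow, Complex.norm_exp, ← Real.exp_nat_mul]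
  congr 2
  simp
  ring

lemma tsum_int_eq_tsum_nat_add_neg_add_one {f : ℤ → ℂ} (hf : Summable f) :
    ∑' n, f n = ∑' n : ℕ, (f n + f (-(n + 1))) := by
  have h1 : Summable fun n : ℕ => f n := hf.comp_injective Nat.cast_injective
  have h2 : Summable fun n : ℕ => f (-(n + 1)) :=
    hf.comp_injective (i := fun n : ℕ => (-(n + 1) : ℤ)) fun a b h => by simpa using h
  rw [tsum_of_nat_of_neg_add_one h1 h2, h1.tsum_add h2]

lemma summable_qSeries_strip (k : ℕ) (x : ℝ) {T : ℝ} (hT : 0 < T) :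
    Summable fun p : ℕ+ × ℕ+ => ((p.2 : ℕ) : ℂ) ^ k *
      Complex.exp (2 * Real.pi * Complex.I * (x + p.1 * (T * Complex.I))) ^ (p.2 : ℕ) := by
  have hr1 : ‖Real.exp (-(2 * Real.pi * T))‖ < 1 := by
    rw [Real.norm_eq_abs, Real.abs_exp, Real.exp_lt_one_iff]
    have := Real.pi_pos
    have : 0 < 2 * Real.pi * T := by positivity
    linarith
  refine Summable.of_norm ((summable_prod_mul_pow k hr1).congr fun p => ?_)
  rw [norm_qSeries_term, ← Real.exp_nat_mul]
  congr 2
  simp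
  ring

lemma summable_qSeries_ray (k : ℕ) {θ T : ℝ} (hθ : 0 < θ) (hT : 0 < T) :
    Summable fun p : ℕ+ × ℕ => ((p.1 : ℕ) : ℂ) ^ k *
      Complex.exp (2 * Real.pi * Complex.I * (Complex.I * ((p.2 + θ) / T))) ^ (p.1 : ℕ) := by
  have hA : 0 < 2 * Real.pi / T := by have := Real.pi_pos; positivity
  refine Summable.of_norm ((summable_pow_mul_exp_prod k hA hθ).congr fun p => ?_)
  rw [norm_qSeries_term]
  congr 2
  have : (Complex.I * (((p.2 : ℂ) + θ) / T)).im = (p.2 + θ) / T := by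
    rw [Complex.I_mul_im]
    norm_cast
  rw [this]
  ring

lemma hasSum_qSeries_strip (k : ℕ) (x : ℝ) {T : ℝ} (hT : 0 < T) :
    HasSum (fun m : ℕ+ => qSeries k (x + m * (T * Complex.I)))
      (∑' p : ℕ+ × ℕ+, ((p.2 : ℕ) : ℂ) ^ k *
        Complex.exp (2 * Real.pi * Complex.I * (x + p.1 * (T * Complex.I))) ^ (p.2 : ℕ)) := by
  have h := summable_qSeries_strip k x hT
  exact h.hasSum.prod_fiberwise fun m => (h.prod_factor m).hasSum

lemma hasSum_qSeries_ray (k : ℕ) {θ T : ℝ} (hθ : 0 < θ) (hT : 0 < T) :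
    HasSum (fun j : ℕ => qSeries k (Complex.I * ((j + θ) / T)))
      (∑' p : ℕ+ × ℕ, ((p.1 : ℕ) : ℂ) ^ k *
        Complex.exp (2 * Real.pi * Complex.I * (Complex.I * ((p.2 + θ) / T))) ^ (p.1 : ℕ)) := by
  have h := summable_qSeries_ray k hθ hT
  rw [← (Equiv.prodComm ℕ ℕ+).tsum_eq]
  exact h.prod_symm.hasSum.prod_fiberwise fun j => (h.prod_symm.prod_factor j).hasSum

/-- Each row or column of the lattice sum becomes a Lipschitz sum in the upper half-plane after a
sign change of the index and extraction of a constant. -/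
lemma tsum_eq_of_equiv_lipschitz {ι : Type*} [Fintype ι] (c z : ι → ℂ) (hz : ∀ i, 0 < (z i).im)
    {k : ℕ} (hk : k ≠ 0 ∨ ∑ i, c i = 0) {f : ℤ → ℂ} (hf : Summable f) (e : ℤ ≃ ℤ) {a : ℂ}
    (ha : a ≠ 0) (h : ∀ n, f (e n) = a * ∑ i, c i / (z i + n) ^ (k + 1)) :
    ∑' n, f n = a * (lipschitzConst k * ∑ i, c i * qSeries k (z i)) := by
  have hs := (e.summable_iff.2 hf).congr (fun n => h n)
  rw [← e.tsum_eq f, tsum_congr h, tsum_mul_left,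
    lipschitz_formula c z hz k hk ((summable_mul_left_iff ha).1 hs)]

/-! ### The lattice sum computed in two orders. -/

/-- The deviation from the transformation law of the twisted Eisenstein series of weight `k + 1`. -/
noncomputable def modularDefect (k : ℕ) (T θ : ℝ) : ℂ :=
  hurwitzDiff θ (1 + k) + lipschitzConst k *
    (∑' m : ℕ+, (qSeries k (θ + m * (T * Complex.I)) -
        qSeries k ((-θ : ℝ) + m * (T * Complex.I))) +
      ((T * Complex.I) ^ (k + 1))⁻¹ *
        ∑' j : ℕ, (qSeries k (Complex.I * ((j + θ) / T)) -
          qSeries k (Complex.I * ((j + (1 - θ : ℝ)) / T))))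

/-- Fubini for ∑ c_i (θ_i + n + m·iT)^(-(k+1)): the row m = 0 gives the Hurwitz difference, the rows
±m give the strip series and the columns give the ray series. Since k+1 is odd, negating a lattice
point flips the sign, which produces the differences. -/
lemma sum_modularDefect_eq_zero {ι : Type*} [Fintype ι] (c : ι → ℂ) (θ : ι → ℝ)
    (h0 : ∀ i, 0 < θ i) (h1 : ∀ i, θ i < 1) {k : ℕ} (hk : Even k) (hk' : k ≠ 0 ∨ ∑ i, c i = 0)
    {T : ℝ} (hT : 0 < T)
    (hsum : Summable fun p : ℤ × ℤ => ∑ i, c i / (θ i + p.2 + p.1 * (T * Complex.I)) ^ (k + 1)) :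
    ∑ i, c i * modularDefect k T (θ i) = 0 := by
  have hodd : Odd (k + 1) := hk.add_one
  set E : ℤ → ℤ → ℂ := fun m n => ∑ i, c i / (θ i + n + m * (T * Complex.I)) ^ (k + 1) with hE
  have hsum1 : Summable fun p : ℤ × ℤ => E p.1 p.2 := hsum
  have hrow : ∀ m, Summable (E m) := fun m => hsum1.prod_factor m
  have hcol : ∀ n, Summable fun m => E m n := fun n => hsum1.prod_symm.prod_factor n
  have hT0 : (T * Complex.I : ℂ) ≠ 0 :=
    mul_ne_zero (by exact_mod_cast hT.ne') Complex.I_ne_zero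
  have hrow0 : ∑' n, E 0 n = ∑ i, c i * hurwitzDiff (θ i) (1 + k) := by
    rw [tsum_int_eq_tsum_nat_add_neg_add_one (hrow 0)]
    refine HasSum.tsum_eq ((hasSum_sum fun i _ =>
      (hasSum_hurwitzDiff_nat (h0 i) (h1 i) k).mul_left (c i)).congr_fun fun n => ?_)
    simp only [hE, ← Finset.sum_add_distrib]
    refine Finset.sum_congr rfl fun i _ => ?_
    -- Pairing n with -(n+1) matches n + θ with n + 1 - θ.
    have e : (θ i + ((-(n + 1) : ℤ) : ℂ) + ((0 : ℤ) : ℂ) * (T * Complex.I)) =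
      -((n : ℂ) + 1 - θ i) := by push_cast; ring
    rw [e, hodd.neg_pow]
    rw [div_neg]
    push_cast
    ring
  have hrowpos : ∀ m : ℕ+, ∑' n, E m n =
      lipschitzConst k * ∑ i, c i * qSeries k (θ i + m * (T * Complex.I)) := by
    intro m
    rw [tsum_eq_of_equiv_lipschitz c (fun i => θ i + m * (T * Complex.I))
      (fun i => by simp; positivity) hk' (hrow m) (Equiv.refl ℤ) one_ne_zero, one_mul]
    intro n
    simp only [hE, one_mul, Equiv.refl_apply, add_right_comm, Int.cast_natCast]
  have hrowneg : ∀ m : ℕ+, ∑' n, E (-m) n =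
      -(lipschitzConst k * ∑ i, c i * qSeries k ((-θ i : ℝ) + m * (T * Complex.I))) := by
    intro m
    rw [tsum_eq_of_equiv_lipschitz c (fun i => (-θ i : ℝ) + m * (T * Complex.I))
      (fun i => by simp; positivity) hk' (hrow (-m)) (Equiv.neg ℤ) (neg_ne_zero.2 one_ne_zero),
      neg_one_mul]
    intro n
    simp only [hE, neg_one_mul, ← Finset.sum_neg_distrib, Equiv.neg_apply]
    refine Finset.sum_congr rfl fun i _ => ?_
    rw [← div_neg, ← hodd.neg_pow]
    push_cast
    ring_nf
  have him : ∀ x : ℝ, 0 < x → 0 < (Complex.I * ((x : ℂ) / T)).im := by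
    intro x hx
    rw [Complex.I_mul_im, ← Complex.ofReal_div, Complex.ofReal_re]
    positivity
  have hTk : ((T * Complex.I) ^ (k + 1))⁻¹ ≠ 0 := inv_ne_zero (pow_ne_zero _ hT0)
  have hI : ∀ w : ℂ, T * Complex.I * (Complex.I * (w / T)) = -w := by
    intro w
    have : (T : ℂ) ≠ 0 := by exact_mod_cast hT.ne'
    field_simp
    rw [Complex.I_sq]
    ring
  have hcolpos : ∀ j : ℕ, ∑' m, E m j = -((T * Complex.I) ^ (k + 1))⁻¹ * (lipschitzConst k *
      ∑ i, c i * qSeries k (Complex.I * ((j + θ i) / T))) := by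
    intro j
    refine tsum_eq_of_equiv_lipschitz c (fun i => Complex.I * ((j + θ i) / T))
      (fun i => ?_) hk' (hcol j) (Equiv.neg ℤ) (neg_ne_zero.2 hTk) ?_
    · have := him (j + θ i) (by have := h0 i; positivity)
      push_cast at this
      exact this
    intro n
    simp only [hE, Finset.mul_sum, Equiv.neg_apply]
    refine Finset.sum_congr rfl fun i _ => ?_
    have e : (θ i + ((j : ℤ) : ℂ) + ((-n : ℤ) : ℂ) * (T * Complex.I)) =
        -((T * Complex.I) * (Complex.I * ((j + θ i) / T) + n)) := by
      rw [mul_add, hI]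
      push_cast
      ring
    rw [e, hodd.neg_pow, mul_pow, div_neg, div_mul_eq_div_div_swap, neg_mul]
    ring
  have hcolneg : ∀ j : ℕ, ∑' m, E m (-(j + 1)) = ((T * Complex.I) ^ (k + 1))⁻¹ * (lipschitzConst k *
      ∑ i, c i * qSeries k (Complex.I * ((j + (1 - θ i : ℝ)) / T))) := by
    intro j
    refine tsum_eq_of_equiv_lipschitz c (fun i => Complex.I * ((j + (1 - θ i : ℝ)) / T))
      (fun i => ?_) hk' (hcol _) (Equiv.refl ℤ) hTk ?_
    · have := him (j + (1 - θ i)) (by have := h1 i; have : 0 < 1 - θ i := by linarith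
                                      positivity)
      push_cast at this ⊢
      exact this
    intro n
    simp only [hE, Finset.mul_sum, Equiv.refl_apply]
    refine Finset.sum_congr rfl fun i _ => ?_
    have e : (θ i + ((-(j + 1) : ℤ) : ℂ) + (n : ℂ) * (T * Complex.I)) =
        (T * Complex.I) * (Complex.I * ((j + (1 - θ i : ℝ)) / T) + n) := by
      rw [mul_add, hI]
      push_cast
      ring
    rw [e, mul_pow, div_mul_eq_div_div_swap]
    ring
  have hSm : ∀ i, Summable fun m : ℕ+ => (qSeries k (θ i + m * (T * Complex.I)) -
      qSeries k ((-θ i : ℝ) + m * (T * Complex.I))) := fun i =>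
    (hasSum_qSeries_strip k (θ i) hT).summable.sub (hasSum_qSeries_strip k (-θ i) hT).summable
  have hSj : ∀ i, Summable fun j : ℕ => (qSeries k (Complex.I * ((j + θ i) / T)) -
      qSeries k (Complex.I * ((j + (1 - θ i : ℝ)) / T))) := fun i =>
    (hasSum_qSeries_ray k (h0 i) hT).summable.sub
      (hasSum_qSeries_ray k (by linarith [h1 i] : 0 < 1 - θ i) hT).summable
  have hA : ∑' p : ℤ × ℤ, E p.1 p.2 = ∑ i, c i * hurwitzDiff (θ i) (1 + k) + lipschitzConst k *
      ∑ i, c i * ∑' m : ℕ+, (qSeries k (θ i + m * (T * Complex.I)) -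
        qSeries k ((-θ i : ℝ) + m * (T * Complex.I))) := by
    rw [hsum1.tsum_prod, tsum_int_eq_zero_add_tsum_pnat_add hsum1.prod, hrow0]
    congr 1
    simp only [hrowpos, hrowneg, ← tsum_mul_left]
    rw [← Summable.tsum_finsetSum fun i _ => (hSm i).mul_left (c i), ← tsum_mul_left]
    refine tsum_congr fun m => ?_
    rw [← sub_eq_add_neg, ← mul_sub, ← Finset.sum_sub_distrib]
    simp only [mul_sub]
  have hB : ∑' p : ℤ × ℤ, E p.1 p.2 = -(lipschitzConst k * ((T * Complex.I) ^ (k + 1))⁻¹ *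
      ∑ i, c i * ∑' j : ℕ, (qSeries k (Complex.I * ((j + θ i) / T)) -
          qSeries k (Complex.I * ((j + (1 - θ i : ℝ)) / T)))) := by
    have hP := hsum1.prod_symm.prod
    simp only [Prod.fst_swap, Prod.snd_swap] at hP
    have hswap : ∑' p : ℤ × ℤ, E p.1 p.2 = ∑' n : ℤ, ∑' m : ℤ, E m n :=
      ((Equiv.prodComm ℤ ℤ).tsum_eq (fun p : ℤ × ℤ => E p.1 p.2)).symm.trans
        hsum1.prod_symm.tsum_prod
    rw [hswap, tsum_int_eq_tsum_nat_add_neg_add_one hP]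
    simp only [hcolpos, hcolneg, ← tsum_mul_left]
    rw [← Summable.tsum_finsetSum fun i _ => (hSj i).mul_left (c i), ← tsum_mul_left, ← tsum_neg]
    refine tsum_congr fun m => ?_
    simp only [mul_sub, Finset.sum_sub_distrib]
    ring
  rw [hA] at hB
  have : ∑ i, c i * modularDefect k T (θ i) = ∑ i, c i * hurwitzDiff (θ i) (1 + k) +
      lipschitzConst k * ∑ i, c i * ∑' m : ℕ+, (qSeries k (θ i + m * (T * Complex.I)) -
        qSeries k ((-θ i : ℝ) + m * (T * Complex.I))) +
      lipschitzConst k * ((T * Complex.I) ^ (k + 1))⁻¹ *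
      ∑ i, c i * ∑' j : ℕ, (qSeries k (Complex.I * ((j + θ i) / T)) -
          qSeries k (Complex.I * ((j + (1 - θ i : ℝ)) / T))) := by
    simp only [modularDefect, Finset.mul_sum, ← Finset.sum_add_distrib]
    exact Finset.sum_congr rfl fun i _ => by ring
  rw [this, hB]
  ring

/-! ### Decay of the lattice terms: weight at least three, and the three-point combination in weight
one. -/

/-- `(|m| + 1)^(-1/2) (|n| + 1)^(-1/2)`. -/
noncomputable def latticeWeight (p : ℤ × ℤ) : ℝ :=
  (|(p.1 : ℝ)| + 1) ^ (-(1 / 2) : ℝ) * (|(p.2 : ℝ)| + 1) ^ (-(1 / 2) : ℝ)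

lemma latticeWeight_nonneg (p : ℤ × ℤ) : 0 ≤ latticeWeight p := by
  unfold latticeWeight; positivity

lemma summable_latticeWeight_pow_three : Summable fun p => latticeWeight p ^ 3 := by
  have h1 : Summable fun n : ℤ => (|(n : ℝ)| + 1) ^ (-(3 / 2) : ℝ) := by
    have h2 : Summable fun n : ℕ => ((n : ℝ) + 1) ^ (-(3 / 2) : ℝ) := by
      refine ((Real.summable_one_div_nat_add_rpow 1 (3 / 2)).2 (by norm_num)).congr fun n => ?_
      rw [abs_of_pos (by positivity), one_div, ← Real.rpow_neg (by positivity)]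
    rw [summable_int_iff_summable_nat_and_neg]
    constructor <;> refine h2.congr fun n => ?_ <;> simp
  have := h1.mul_of_nonneg h1 (fun n => by positivity) (fun n => by positivity)
  refine this.congr fun p => ?_
  rw [latticeWeight, mul_pow, ← Real.rpow_natCast, ← Real.rpow_natCast, ← Real.rpow_mul (by positivity),
    ← Real.rpow_mul (by positivity)]
  norm_num

/-- The norm of a lattice point dominates both |m|+1 and |n|+1, hence their geometric mean. In
product form, the cube of the bound is a product of two convergent one-dimensional series with
exponent 3/2. -/
lemma exists_norm_lattice_inv_le {θ T : ℝ} (h0 : 0 < θ) (h1 : θ < 1) (hT : 0 < T) :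
    ∃ K : ℝ, 0 ≤ K ∧ ∀ p : ℤ × ℤ, (θ + p.2 + p.1 * (T * Complex.I) : ℂ) ≠ 0 ∧
      ‖(θ + p.2 + p.1 * (T * Complex.I) : ℂ)⁻¹‖ ≤ K * latticeWeight p := by
  -- The halving leaves room for |θ + n| ≥ δ(|n| + 1) at the two integers nearest to -θ, namely n =
  -- 0 and n = -1.
  set δ := min θ (1 - θ) / 2 with hδ
  have hδ0 : 0 < δ := half_pos (lt_min h0 (by linarith))
  have ha : 2 * δ ≤ θ := by rw [hδ]; linarith [min_le_left θ (1 - θ)]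
  have hb : 2 * δ ≤ 1 - θ := by rw [hδ]; linarith [min_le_right θ (1 - θ)]
  set c := δ / (1 / T + 1 / δ) with hc
  have hc0 : 0 < c := by positivity
  refine ⟨c ^ (-(1 / 2) : ℝ), by positivity, fun p => ?_⟩
  obtain ⟨m, n⟩ := p
  set w : ℂ := θ + n + m * (T * Complex.I) with hw
  have hre : w.re = θ + n := by simp [hw]
  have him : w.im = m * T := by simp [hw]
  have hn : δ * (|(n : ℝ)| + 1) ≤ |θ + n| := by
    rcases le_or_gt 0 n with h | h
    · have h' : (0 : ℝ) ≤ n := by exact_mod_cast h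
      rw [abs_of_nonneg h', abs_of_nonneg (by positivity)]
      nlinarith
    · have h' : (n : ℝ) ≤ -1 := by exact_mod_cast Int.le_sub_one_of_lt h
      rw [abs_of_nonpos (by linarith), abs_of_nonpos (by linarith)]
      nlinarith
  have hwn : δ * (|(n : ℝ)| + 1) ≤ ‖w‖ := hn.trans (hre ▸ Complex.abs_re_le_norm w)
  have hwm : |(m : ℝ)| * T ≤ ‖w‖ := by
    have := Complex.abs_im_le_norm w
    rwa [him, abs_mul, abs_of_pos hT] at this
  have hwm' : |(m : ℝ)| + 1 ≤ ‖w‖ * (1 / T + 1 / δ) := by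
    have e1 : |(m : ℝ)| ≤ ‖w‖ * (1 / T) := by rw [mul_one_div, le_div_iff₀ hT]; exact hwm
    have e2 : 1 ≤ ‖w‖ * (1 / δ) := by
      rw [mul_one_div, le_div_iff₀ hδ0]
      nlinarith [abs_nonneg (n : ℝ)]
    linarith
  have hsq : c * ((|(m : ℝ)| + 1) * (|(n : ℝ)| + 1)) ≤ ‖w‖ ^ 2 := by
    have hx : 0 < 1 / T + 1 / δ := by positivity
    rw [hc, div_mul_eq_mul_div, div_le_iff₀ hx]
    calc δ * ((|(m : ℝ)| + 1) * (|(n : ℝ)| + 1)) = (δ * (|(n : ℝ)| + 1)) * (|(m : ℝ)| + 1) := by ring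
      _ ≤ ‖w‖ * (‖w‖ * (1 / T + 1 / δ)) := by gcongr
      _ = ‖w‖ ^ 2 * (1 / T + 1 / δ) := by ring
  have hpos : 0 < c * ((|(m : ℝ)| + 1) * (|(n : ℝ)| + 1)) := by positivity
  have hw0 : 0 < ‖w‖ := lt_of_lt_of_le (by positivity) hwn
  refine ⟨norm_pos_iff.1 hw0, ?_⟩
  rw [norm_inv, latticeWeight, ← Real.mul_rpow (by positivity) (by positivity),
    ← Real.mul_rpow (by positivity) (by positivity)]
  calc ‖w‖⁻¹ = (‖w‖ ^ 2) ^ (-(1 / 2) : ℝ) := by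
        rw [← Real.rpow_natCast, ← Real.rpow_mul (norm_nonneg _)]
        norm_num [Real.rpow_neg_one]
    _ ≤ _ := Real.rpow_le_rpow_of_nonpos hpos hsq (by norm_num)

lemma latticeWeight_le_one (p : ℤ × ℤ) : latticeWeight p ≤ 1 := by
  have h : ∀ x : ℝ, (|x| + 1) ^ (-(1 / 2) : ℝ) ≤ 1 := fun x =>
    Real.rpow_le_one_of_one_le_of_nonpos (by linarith [abs_nonneg x]) (by norm_num)
  exact mul_le_one₀ (h _) (by positivity) (h _)

lemma modularDefect_eq_zero {k : ℕ} (hk : Even k) (hk0 : k ≠ 0) {θ T : ℝ} (h0 : 0 < θ) (h1 : θ < 1)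
    (hT : 0 < T) : modularDefect k T θ = 0 := by
  have h := sum_modularDefect_eq_zero (fun _ : Unit => 1) (fun _ => θ) (fun _ => h0) (fun _ => h1)
    hk (.inl hk0) hT ?_
  · simpa using h
  · obtain ⟨K, hK, hb⟩ := exists_norm_lattice_inv_le h0 h1 hT
    have hk2 : 2 ≤ k := by
      rcases hk with ⟨j, rfl⟩
      omega
    obtain ⟨l, rfl⟩ := Nat.exists_eq_add_of_le hk2
    refine Summable.of_norm_bounded (summable_latticeWeight_pow_three.mul_left (K ^ (2 + l + 1)))
      fun p => ?_
    simp only [Finset.univ_unique, Finset.sum_singleton, one_div, norm_inv, norm_pow]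
    have hw := (hb p).2
    rw [norm_inv] at hw
    calc (‖(θ + p.2 + p.1 * (T * Complex.I) : ℂ)‖ ^ (2 + l + 1))⁻¹
        = ‖(θ + p.2 + p.1 * (T * Complex.I) : ℂ)‖⁻¹ ^ (2 + l + 1) := (inv_pow _ _).symm
      _ ≤ (K * latticeWeight p) ^ (2 + l + 1) := by gcongr
      _ = K ^ (2 + l + 1) * (latticeWeight p ^ 3 * latticeWeight p ^ l) := by ring
      _ ≤ K ^ (2 + l + 1) * (latticeWeight p ^ 3 * 1) := by
        have := latticeWeight_nonneg p
        gcongr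
        exact pow_le_one₀ this (latticeWeight_le_one p)
      _ = _ := by rw [mul_one]

/-- The coefficients satisfy ∑c_i = 0 and ∑c_iθ_i = 0, so ∑ c_i/(θ_i + w) has constant numerator
over a cubic and decays like |w|^(-3). The conclusion says that the weight-one defect is affine in
θ. -/
lemma modularDefect_zero_three_points {θ₁ θ₂ θ₃ T : ℝ} (h₁ : θ₁ ∈ Ioo (0 : ℝ) 1)
    (h₂ : θ₂ ∈ Ioo (0 : ℝ) 1) (h₃ : θ₃ ∈ Ioo (0 : ℝ) 1) (hT : 0 < T) :
    (θ₂ - θ₃) * modularDefect 0 T θ₁ + (θ₃ - θ₁) * modularDefect 0 T θ₂ +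
      (θ₁ - θ₂) * modularDefect 0 T θ₃ = 0 := by
  have h := sum_modularDefect_eq_zero ![(θ₂ - θ₃ : ℂ), θ₃ - θ₁, θ₁ - θ₂] ![θ₁, θ₂, θ₃]
    (k := 0) (T := T) ?_ ?_ Even.zero (.inr ?_) hT ?_
  · simpa [Fin.sum_univ_three] using h
  · intro i; fin_cases i
    exacts [h₁.1, h₂.1, h₃.1]
  · intro i; fin_cases i
    exacts [h₁.2, h₂.2, h₃.2]
  · simp [Fin.sum_univ_three]
  · obtain ⟨K₁, hK₁, hb₁⟩ := exists_norm_lattice_inv_le h₁.1 h₁.2 hT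
    obtain ⟨K₂, hK₂, hb₂⟩ := exists_norm_lattice_inv_le h₂.1 h₂.2 hT
    obtain ⟨K₃, hK₃, hb₃⟩ := exists_norm_lattice_inv_le h₃.1 h₃.2 hT
    set C : ℂ := (θ₂ - θ₃) * (θ₂ * θ₃) + (θ₃ - θ₁) * (θ₁ * θ₃) + (θ₁ - θ₂) * (θ₁ * θ₂) with hC
    refine Summable.of_norm_bounded
      (summable_latticeWeight_pow_three.mul_left (‖C‖ * (K₁ * K₂ * K₃))) fun p => ?_
    have e : ∑ i, ![(θ₂ - θ₃ : ℂ), θ₃ - θ₁, θ₁ - θ₂] i /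
        ((![θ₁, θ₂, θ₃] i : ℝ) + p.2 + p.1 * (T * Complex.I) : ℂ) ^ (0 + 1) =
        C * ((θ₁ + p.2 + p.1 * (T * Complex.I) : ℂ)⁻¹ * (θ₂ + p.2 + p.1 * (T * Complex.I) : ℂ)⁻¹ *
          (θ₃ + p.2 + p.1 * (T * Complex.I) : ℂ)⁻¹) := by
      have n1 := (hb₁ p).1
      have n2 := (hb₂ p).1
      have n3 := (hb₃ p).1
      simp only [Fin.sum_univ_three, zero_add, pow_one, Matrix.cons_val_zero, Matrix.cons_val_one,
        Matrix.cons_val]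
      rw [hC]
      generalize (p.2 : ℂ) = n at *
      generalize (p.1 * (T * Complex.I) : ℂ) = m at *
      field_simp
      ring
    rw [e, norm_mul, norm_mul, norm_mul]
    have hw := latticeWeight_nonneg p
    calc _ ≤ ‖C‖ * ((K₁ * latticeWeight p) * (K₂ * latticeWeight p) * (K₃ * latticeWeight p)) := by
          exact mul_le_mul_of_nonneg_left (mul_le_mul (mul_le_mul (hb₁ p).2 (hb₂ p).2
            (norm_nonneg _) (by positivity)) (hb₃ p).2 (norm_nonneg _) (by positivity))
            (norm_nonneg _)
      _ = _ := by ring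

lemma qSeries_add_one (k : ℕ) (z : ℂ) : qSeries k (z + 1) = qSeries k z := by
  have : Complex.exp (2 * Real.pi * Complex.I * (z + 1)) =
      Complex.exp (2 * Real.pi * Complex.I * z) := by
    rw [mul_add, mul_one, Complex.exp_add, Complex.exp_two_pi_mul_I, mul_one]
  rw [qSeries, qSeries, this]

lemma modularDefect_one_sub (k : ℕ) (T θ : ℝ) :
    modularDefect k T (1 - θ) = -modularDefect k T θ := by
  have e1 : ∀ m : ℕ+, qSeries k (((1 - θ : ℝ) : ℂ) + m * (T * Complex.I)) -
      qSeries k ((-(1 - θ) : ℝ) + m * (T * Complex.I)) =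
      -(qSeries k (θ + m * (T * Complex.I)) - qSeries k ((-θ : ℝ) + m * (T * Complex.I))) := by
    intro m
    rw [← qSeries_add_one k ((-(1 - θ) : ℝ) + _), ← qSeries_add_one k ((-θ : ℝ) + _)]
    push_cast
    ring_nf
  have e2 : ∀ j : ℕ, qSeries k (Complex.I * ((j + (1 - θ : ℝ)) / T)) -
      qSeries k (Complex.I * ((j + (1 - (1 - θ) : ℝ)) / T)) =
      -(qSeries k (Complex.I * ((j + θ) / T)) -
          qSeries k (Complex.I * ((j + (1 - θ : ℝ)) / T))) := by
    intro j
    rw [sub_sub_cancel]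
    ring
  rw [modularDefect, modularDefect, hurwitzDiff_one_sub, tsum_congr e1, tsum_congr e2, tsum_neg,
    tsum_neg]
  ring

/-- Apply the three-point relation to θ, ε and 1-ε, using oddness under ε ↦ 1-ε. -/
lemma modularDefect_zero_proportional {θ ε T : ℝ} (h : θ ∈ Ioo (0 : ℝ) 1) (hε : ε ∈ Ioo (0 : ℝ) 1)
    (hT : 0 < T) :
    (1 - 2 * ε) * modularDefect 0 T θ = (1 - 2 * θ) * modularDefect 0 T ε := by
  have := modularDefect_zero_three_points h hε
    (⟨by linarith [hε.2], by linarith [hε.1]⟩ : 1 - ε ∈ Ioo (0 : ℝ) 1) hT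
  rw [modularDefect_one_sub] at this
  push_cast at this
  linear_combination -this

/-! ### The constant in weight one, by letting θ tend to 0. -/

lemma tendsto_inv_exp_sub_one_sub_inv :
    Tendsto (fun u : ℝ => (Real.exp u - 1)⁻¹ - u⁻¹) (𝓝[>] 0) (𝓝 (-(1 / 2))) := by
  have h1 : Tendsto (fun u : ℝ => (Real.exp u - 1) / u) (𝓝[>] 0) (𝓝 1) := by
    have := (Real.hasDerivAt_exp 0).tendsto_slope.mono_left
      (nhdsWithin_mono (0 : ℝ) fun x (hx : 0 < x) => hx.ne')
    rw [Real.exp_zero] at this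
    refine this.congr fun u => ?_
    rw [slope_def_field, Real.exp_zero, sub_zero]
  have h2 : Tendsto (fun u : ℝ => (Real.exp u - 1 - u) / u ^ 2) (𝓝[>] 0) (𝓝 (1 / 2)) := by
    have hz : Tendsto (fun u : ℝ => (Real.exp u - 1 - u) / u ^ 2 - 1 / 2) (𝓝[>] 0) (𝓝 0) := by
      have hid : Tendsto (fun u : ℝ => u) (𝓝[>] 0) (𝓝 0) :=
        tendsto_nhdsWithin_of_tendsto_nhds tendsto_id
      refine squeeze_zero_norm' ?_ hid
      filter_upwards [Ioo_mem_nhdsGT (zero_lt_one' ℝ)] with u hu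
      have hu0 : 0 < u := hu.1
      have hb := Real.exp_bound (x := u) (by rw [abs_of_pos hu0]; exact hu.2.le) (n := 3) (by norm_num)
      rw [abs_of_pos hu0] at hb
      norm_num [Finset.sum_range_succ, Nat.factorial] at hb
      have e : (Real.exp u - 1 - u) / u ^ 2 - 1 / 2 = (Real.exp u - (1 + u + u ^ 2 / 2)) / u ^ 2 := by
        field_simp
        ring
      rw [e, Real.norm_eq_abs, abs_div, abs_of_pos (pow_pos hu0 2), div_le_iff₀ (pow_pos hu0 2)]
      have : 0 < u ^ 3 := pow_pos hu0 3
      nlinarith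
    exact tendsto_sub_nhds_zero_iff.1 hz
  have h3 := (h2.div h1 one_ne_zero).neg
  rw [div_one] at h3
  refine h3.congr' ?_
  filter_upwards [self_mem_nhdsWithin] with u hu
  have hu : 0 < u := hu
  have : Real.exp u - 1 ≠ 0 := by
    have := Real.add_one_lt_exp hu.ne'
    linarith
  simp only [Pi.div_apply]
  field_simp
  ring

lemma tendsto_hurwitzDiff_one_sub_inv :
    Tendsto (fun ε : ℝ => hurwitzDiff ε 1 - 1 / ε) (𝓝[>] 0) (𝓝 0) := by
  have hbound : ∀ ε ∈ Ioo (0 : ℝ) (1 / 2), ∀ n : ℕ,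
      ‖(1 / ((n : ℂ) + 1 + ε) - 1 / ((n : ℂ) + 1 - ε))‖ ≤ 2 * (1 / ((n : ℝ) + 1) ^ 2) := by
    intro ε hε n
    have hε0 := hε.1
    have hε1 := hε.2
    have hn : (0 : ℝ) ≤ n := Nat.cast_nonneg n
    have e : (1 / ((n : ℂ) + 1 + ε) - 1 / ((n : ℂ) + 1 - ε)) =
        ((1 / ((n : ℝ) + 1 + ε) - 1 / ((n : ℝ) + 1 - ε) : ℝ) : ℂ) := by push_cast; rfl
    have hp : (0 : ℝ) < n + 1 + ε := by positivity
    have hq : (0 : ℝ) < n + 1 - ε := by linarith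
    have hd : (1 / ((n : ℝ) + 1 + ε) - 1 / ((n : ℝ) + 1 - ε)) =
        -(2 * ε / ((n + 1 + ε) * (n + 1 - ε))) := by
      field_simp
      ring
    rw [e, Complex.norm_real, hd, norm_neg, Real.norm_eq_abs, abs_of_pos (by positivity),
      mul_one_div, div_le_div_iff₀ (by positivity) (by positivity)]
    nlinarith [sq_nonneg ((n : ℝ) + 1), mul_pos hε0 hε0]
  have hsum : Summable fun n : ℕ => 2 * (1 / ((n : ℝ) + 1) ^ 2) := by
    refine Summable.mul_left 2 ?_
    exact_mod_cast (summable_nat_add_iff 1).2 (Real.summable_one_div_nat_pow.2 one_lt_two)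
  have hlim : Tendsto (fun ε : ℝ => ∑' n : ℕ, (1 / ((n : ℂ) + 1 + ε) - 1 / ((n : ℂ) + 1 - ε)))
      (𝓝[>] 0) (𝓝 (∑' _ : ℕ, (0 : ℂ))) := by
    refine tendsto_tsum_of_dominated_convergence hsum (fun n => ?_) ?_
    · refine tendsto_nhdsWithin_of_tendsto_nhds ?_
      have hn : ((n : ℂ) + 1) ≠ 0 := by exact_mod_cast n.succ_ne_zero
      have hc : ContinuousAt (fun ε : ℝ => 1 / ((n : ℂ) + 1 + ε) - 1 / ((n : ℂ) + 1 - ε)) 0 := by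
        refine (continuousAt_const.div (by fun_prop) (by simpa using hn)).sub
          (continuousAt_const.div (by fun_prop) (by simpa using hn))
      simpa using hc.tendsto
    · filter_upwards [Ioo_mem_nhdsGT (by norm_num : (0 : ℝ) < 1 / 2)] with ε hε n
      exact hbound ε hε n
  rw [tsum_zero] at hlim
  refine hlim.congr' ?_
  filter_upwards [Ioo_mem_nhdsGT (by norm_num : (0 : ℝ) < 1 / 2)] with ε hε
  have h := hasSum_hurwitzDiff_nat hε.1 (by linarith [hε.2]) 0
  simp only [zero_add, pow_one, Nat.cast_zero, add_zero] at h
  refine HasSum.tsum_eq ?_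
  rw [(Summable.of_norm_bounded hsum (hbound ε hε)).hasSum_iff_tendsto_nat]
  have ha : Tendsto (fun N : ℕ => 1 / ((N : ℂ) + ε)) atTop (𝓝 0) := by
    have h1 : Tendsto (fun N : ℕ => 1 / ((N : ℝ) + ε)) atTop (𝓝 0) :=
      tendsto_const_nhds.div_atTop (tendsto_atTop_add_const_right _ _ tendsto_natCast_atTop_atTop)
    have h2 := (Complex.continuous_ofReal.tendsto 0).comp h1
    simpa [Function.comp_def] using h2
  -- Shifting only the first member of each pair by one index changes the partial sums by 1/(N+ε) -
  -- 1/ε, so removing the pole 1/ε leaves a series dominated uniformly in ε.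
  have hN := h.tendsto_sum_nat.add (ha.sub_const (1 / (ε : ℂ)))
  rw [zero_sub, ← sub_eq_add_neg] at hN
  refine hN.congr fun N => ?_
  have ht := Finset.sum_range_sub (fun n : ℕ => 1 / ((n : ℂ) + ε)) N
  simp only [Nat.cast_zero, zero_add] at ht
  rw [← ht, ← Finset.sum_add_distrib]
  refine Finset.sum_congr rfl fun n _ => ?_
  push_cast
  ring

lemma qSeries_zero_I_mul {v : ℝ} (hv : 0 < v) :
    qSeries 0 (Complex.I * v) = (((Real.exp (2 * Real.pi * v) - 1)⁻¹ : ℝ) : ℂ) := by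
  have hx : 0 < 2 * Real.pi * v := by have := Real.pi_pos; positivity
  set r : ℝ := Real.exp (-(2 * Real.pi * v)) with hr
  have hr1 : r < 1 := by rw [hr, Real.exp_lt_one_iff]; linarith
  have e : Complex.exp (2 * Real.pi * Complex.I * (Complex.I * v)) = (r : ℂ) := by
    rw [hr, Complex.ofReal_exp]
    congr 1
    push_cast
    linear_combination (2 * Real.pi * v) * Complex.I_sq
  have hg := (hasSum_geometric_of_lt_one (Real.exp_pos _).le hr1).mul_left r
  have hs : HasSum (fun d : ℕ+ => r ^ (d : ℕ)) (r * (1 - r)⁻¹) := by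
    rw [hasSum_pnat_iff_hasSum_succ (f := fun d : ℕ => r ^ d)]
    exact hg.congr_fun fun n => by rw [pow_succ']
  rw [qSeries, e]
  have h2 := (Complex.hasSum_ofReal.2 hs).tsum_eq
  simp only [pow_zero, one_mul]
  push_cast at h2 ⊢
  rw [h2, hr]
  have h3 : (Real.exp (-(2 * Real.pi * v)) : ℂ) = (Complex.exp (2 * Real.pi * v))⁻¹ := by
    rw [Real.exp_neg]; push_cast; rfl
  have h4 : Complex.exp (2 * Real.pi * v) - 1 ≠ 0 := by
    have := Real.add_one_lt_exp hx.ne'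
    have h5 : Real.exp (2 * Real.pi * v) - 1 ≠ 0 := by linarith
    exact_mod_cast h5
  rw [h3]
  field_simp

lemma tendsto_strip_difference (k : ℕ) {T : ℝ} (hT : 0 < T) :
    Tendsto (fun ε : ℝ => ∑' m : ℕ+, (qSeries k (ε + m * (T * Complex.I)) -
      qSeries k ((-ε : ℝ) + m * (T * Complex.I)))) (𝓝[>] 0) (𝓝 0) := by
  have heq : ∀ ε : ℝ, ∑' m : ℕ+, (qSeries k (ε + m * (T * Complex.I)) -
      qSeries k ((-ε : ℝ) + m * (T * Complex.I))) = ∑' p : ℕ+ × ℕ+, (((p.2 : ℕ) : ℂ) ^ k *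
        Complex.exp (2 * Real.pi * Complex.I * (ε + p.1 * (T * Complex.I))) ^ (p.2 : ℕ) -
        ((p.2 : ℕ) : ℂ) ^ k * Complex.exp (2 * Real.pi * Complex.I *
          ((-ε : ℝ) + p.1 * (T * Complex.I))) ^ (p.2 : ℕ)) := fun ε => by
    rw [(summable_qSeries_strip k ε hT).tsum_sub (summable_qSeries_strip k (-ε) hT)]
    exact ((hasSum_qSeries_strip k ε hT).sub (hasSum_qSeries_strip k (-ε) hT)).tsum_eq
  have h0 : (0 : ℂ) = ∑' _ : ℕ+ × ℕ+, (0 : ℂ) := tsum_zero.symm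
  rw [h0]
  simp only [heq]
  refine tendsto_tsum_of_dominated_convergence
    ((summable_qSeries_strip k 0 hT).norm.mul_left 2) (fun p => ?_) (.of_forall fun ε p => ?_)
  · refine tendsto_nhdsWithin_of_tendsto_nhds ?_
    have hc : Continuous fun ε : ℝ => (((p.2 : ℕ) : ℂ) ^ k *
        Complex.exp (2 * Real.pi * Complex.I * (ε + p.1 * (T * Complex.I))) ^ (p.2 : ℕ) -
        ((p.2 : ℕ) : ℂ) ^ k * Complex.exp (2 * Real.pi * Complex.I *
          ((-ε : ℝ) + p.1 * (T * Complex.I))) ^ (p.2 : ℕ)) := by fun_prop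
    simpa using hc.tendsto 0
  · refine (norm_sub_le _ _).trans (le_of_eq ?_)
    rw [norm_qSeries_term, norm_qSeries_term, norm_qSeries_term]
    simp
    ring

lemma tendsto_ray_difference (k : ℕ) {T : ℝ} (hT : 0 < T) :
    Tendsto (fun ε : ℝ => ∑' j : ℕ, (qSeries k (Complex.I * ((j + (1 + ε : ℝ)) / T)) -
      qSeries k (Complex.I * ((j + (1 - ε : ℝ)) / T)))) (𝓝[>] 0) (𝓝 0) := by
  have heq : ∀ ε ∈ Ioo (0 : ℝ) (1 / 2),
      ∑' p : ℕ+ × ℕ, (((p.1 : ℕ) : ℂ) ^ k * Complex.exp (2 * Real.pi * Complex.I *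
          (Complex.I * ((p.2 + (1 + ε : ℝ)) / T))) ^ (p.1 : ℕ) -
        ((p.1 : ℕ) : ℂ) ^ k * Complex.exp (2 * Real.pi * Complex.I *
          (Complex.I * ((p.2 + (1 - ε : ℝ)) / T))) ^ (p.1 : ℕ)) =
      ∑' j : ℕ, (qSeries k (Complex.I * ((j + (1 + ε : ℝ)) / T)) -
        qSeries k (Complex.I * ((j + (1 - ε : ℝ)) / T))) := fun ε hε => by
    have h1 : 0 < 1 + ε := by linarith [hε.1]
    have h2 : 0 < 1 - ε := by linarith [hε.2]
    rw [(summable_qSeries_ray k h1 hT).tsum_sub (summable_qSeries_ray k h2 hT)]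
    exact ((hasSum_qSeries_ray k h1 hT).sub (hasSum_qSeries_ray k h2 hT)).tsum_eq.symm
  have h0 : (0 : ℂ) = ∑' _ : ℕ+ × ℕ, (0 : ℂ) := tsum_zero.symm
  have hmem := Ioo_mem_nhdsGT (by norm_num : (0 : ℝ) < 1 / 2)
  rw [h0]
  refine Tendsto.congr' (by filter_upwards [hmem] with ε hε using heq ε hε) ?_
  refine tendsto_tsum_of_dominated_convergence
    -- For ε < 1/2 both shifts 1 ± ε are at least 1/2, so the ray with parameter 1/2 is a uniform
    -- majorant.
    ((summable_qSeries_ray k (θ := 1 / 2) (by norm_num) hT).norm.mul_left 2) (fun p => ?_) ?_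
  · refine tendsto_nhdsWithin_of_tendsto_nhds ?_
    have hc : Continuous fun ε : ℝ => (((p.1 : ℕ) : ℂ) ^ k * Complex.exp (2 * Real.pi * Complex.I *
          (Complex.I * ((p.2 + (1 + ε : ℝ)) / T))) ^ (p.1 : ℕ) -
        ((p.1 : ℕ) : ℂ) ^ k * Complex.exp (2 * Real.pi * Complex.I *
          (Complex.I * ((p.2 + (1 - ε : ℝ)) / T))) ^ (p.1 : ℕ)) := by fun_prop
    simpa using hc.tendsto 0
  · filter_upwards [hmem] with ε hε p
    refine (norm_sub_le _ _).trans ?_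
    rw [norm_qSeries_term, norm_qSeries_term, norm_qSeries_term]
    have him : ∀ x : ℝ, (Complex.I * (((p.2 : ℂ) + x) / T)).im = (p.2 + x) / T := fun x => by
      rw [Complex.I_mul_im]
      norm_cast
    have hle : ∀ x : ℝ, 1 / 2 ≤ x → ((p.1 : ℕ) : ℝ) ^ k *
        Real.exp (-(2 * Real.pi * ((p.2 + x) / T) * (p.1 : ℕ))) ≤ ((p.1 : ℕ) : ℝ) ^ k *
        Real.exp (-(2 * Real.pi * ((p.2 + 1 / 2) / T) * (p.1 : ℕ))) := fun x hx => by
      have := Real.pi_pos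
      gcongr
    rw [him, him, him]
    linarith [hle (1 + ε) (by linarith [hε.1]), hle (1 - ε) (by linarith [hε.2])]

/-- Only two pieces survive: the pole 1/ε of the Hurwitz difference and the ray term j = 0, which is
1/(e^(2πε/T) - 1) = T/(2πε) - 1/2 + o(1). Multiplied by -2π/T, the latter cancels the pole and
leaves π/T. -/
lemma tendsto_modularDefect_zero {T : ℝ} (hT : 0 < T) :
    Tendsto (fun ε : ℝ => modularDefect 0 T ε) (𝓝[>] 0) (𝓝 (Real.pi / T)) := by
  have hpi := Real.pi_pos
  have hT0 : (T : ℂ) ≠ 0 := by exact_mod_cast hT.ne'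
  have hg : Tendsto (fun ε : ℝ => 2 * Real.pi * (ε / T)) (𝓝[>] 0) (𝓝[>] 0) := by
    refine tendsto_nhdsWithin_iff.2 ⟨tendsto_nhdsWithin_of_tendsto_nhds ?_, ?_⟩
    · have hc : Continuous fun ε : ℝ => 2 * Real.pi * (ε / T) := by fun_prop
      simpa using hc.tendsto 0
    · filter_upwards [self_mem_nhdsWithin] with ε hε
      have hε : 0 < ε := hε
      exact mem_Ioi.2 (by positivity)
  have hL : Tendsto (fun ε : ℝ => qSeries 0 (Complex.I * (ε / T)) - T / (2 * Real.pi * ε))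
      (𝓝[>] 0) (𝓝 (-(1 / 2))) := by
    have h := (Complex.continuous_ofReal.tendsto _).comp (tendsto_inv_exp_sub_one_sub_inv.comp hg)
    push_cast at h
    refine h.congr' ?_
    filter_upwards [self_mem_nhdsWithin] with ε hε
    have hε : 0 < ε := hε
    have := qSeries_zero_I_mul (v := ε / T) (by positivity)
    push_cast at this
    rw [this]
    simp only [Function.comp_apply]
    push_cast
    congr 1
    field_simp
  have h := (tendsto_hurwitzDiff_one_sub_inv.add ((tendsto_strip_difference 0 hT).const_mul
    (lipschitzConst 0))).add ((hL.add (tendsto_ray_difference 0 hT)).const_mul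
      (lipschitzConst 0 * (T * Complex.I)⁻¹))
  have hconst : lipschitzConst 0 * (T * Complex.I)⁻¹ = -2 * Real.pi / T := by
    simp only [lipschitzConst, zero_add, pow_one, Nat.factorial_zero, Nat.cast_one, div_one]
    field_simp [Complex.I_ne_zero]
  rw [hconst] at h
  have e : (0 + lipschitzConst 0 * 0 + -2 * Real.pi / T * (-(1 / 2) + 0) : ℂ) = Real.pi / T := by
    ring
  rw [e] at h
  refine h.congr' ?_
  filter_upwards [Ioo_mem_nhdsGT (by norm_num : (0 : ℝ) < 1 / 2)] with ε hε
  have hε0 := hε.1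
  have ha := (hasSum_qSeries_ray 0 hε.1 hT).summable
  have hb := (hasSum_qSeries_ray 0 (by linarith [hε.2] : 0 < 1 - ε) hT).summable
  have hc := (hasSum_qSeries_ray 0 (by linarith [hε.1] : 0 < 1 + ε) hT).summable
  -- Splitting off the singular term j = 0 shifts the rest to parameter 1 + ε, which pairs with 1 -
  -- ε and vanishes in the limit.
  have hG : ∑' j : ℕ, (qSeries 0 (Complex.I * ((j + ε) / T)) -
      qSeries 0 (Complex.I * ((j + (1 - ε : ℝ)) / T))) = qSeries 0 (Complex.I * (ε / T)) +
      ∑' j : ℕ, (qSeries 0 (Complex.I * ((j + (1 + ε : ℝ)) / T)) -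
      qSeries 0 (Complex.I * ((j + (1 - ε : ℝ)) / T))) := by
    rw [ha.tsum_sub hb, hc.tsum_sub hb, ha.tsum_eq_zero_add]
    simp only [Nat.cast_zero, zero_add, Nat.cast_add, Nat.cast_one, Complex.ofReal_add,
      Complex.ofReal_one, add_assoc]
    ring
  have hεc : (ε : ℂ) ≠ 0 := by exact_mod_cast hε0.ne'
  have hpc : (Real.pi : ℂ) ≠ 0 := by exact_mod_cast hpi.ne'
  have hcancel : (-2 * Real.pi / T : ℂ) * (T / (2 * Real.pi * ε)) = -(1 / ε) := by
    field_simp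
  simp only [modularDefect, hG, Nat.cast_zero, add_zero, zero_add, pow_one]
  rw [mul_add (lipschitzConst 0), ← mul_assoc, hconst]
  linear_combination -hcancel

/-- The transformation law of the twisted Eisenstein series. -/
theorem modularDefect_eq {k : ℕ} (hk : Even k) {θ T : ℝ} (h0 : 0 < θ) (h1 : θ < 1) (hT : 0 < T) :
    modularDefect k T θ = deltaK k * (Real.pi / T) * hurwitzDiff θ 0 := by
  rcases eq_or_ne k 0 with rfl | hk0
  · have hl : Tendsto (fun ε : ℝ => (1 - 2 * ε : ℂ) * modularDefect 0 T θ) (𝓝[>] 0)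
        (𝓝 (modularDefect 0 T θ)) := by
      refine tendsto_nhdsWithin_of_tendsto_nhds ?_
      have hc : Continuous fun ε : ℝ => (1 - 2 * ε : ℂ) * modularDefect 0 T θ := by fun_prop
      simpa using hc.tendsto 0
    have hr := (tendsto_modularDefect_zero hT).const_mul (1 - 2 * θ : ℂ)
    have := tendsto_nhds_unique (hl.congr' ?_) hr
    · rw [this, hurwitzDiff_zero h0 h1, deltaK, if_pos rfl]
      ring
    · filter_upwards [Ioo_mem_nhdsGT (zero_lt_one' ℝ)] with ε hε
      exact modularDefect_zero_proportional ⟨h0, h1⟩ hε hT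
  · rw [modularDefect_eq_zero hk hk0 h0 h1 hT, deltaK, if_neg hk0]
    ring

/-! ### The Bessel series as an integral of the divisor-sum series. -/

lemma HasSum.sum_divisors {f : ℕ → ℕ → ℂ} {s : ℂ}
    (hf : HasSum (fun p : ℕ+ × ℕ+ => f p.1 p.2) s) :
    HasSum (fun n : ℕ+ => ∑ d ∈ (n : ℕ).divisors, f d ((n : ℕ) / d)) s := by
  have h := (sigmaAntidiagonalEquivProd.hasSum_iff.2 hf).sigma fun n => hasSum_fintype _
  refine h.congr_fun fun n => ?_
  rw [← Nat.sum_divisorsAntidiagonal f, ← Finset.sum_coe_sort]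
  rfl

lemma norm_besselMellin_integrand_le {ν : ℂ} {y t : ℝ} (hy : 0 < y) (ht : 0 < t) (N : ℕ) :
    ‖(t : ℂ) ^ (ν - 1) • besselKernel y t‖ ≤
      N.factorial / y ^ N * (t ^ (ν.re + N - 1) * Real.exp (-(1 * t))) := by
  rw [norm_smul, Complex.norm_cpow_eq_rpow_re_of_pos ht, norm_besselKernel, neg_add, Real.exp_add]
  have h := Real.exp_neg_le_factorial_div_pow (u := y / t) (by positivity) N
  have e : t ^ (ν.re + N - 1) = t ^ (ν - 1).re * t ^ N := by
    rw [← Real.rpow_natCast, ← Real.rpow_add ht]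
    congr 1
    simp
    ring
  calc t ^ (ν - 1).re * (Real.exp (-t) * Real.exp (-(y / t)))
      ≤ t ^ (ν - 1).re * (Real.exp (-t) * (N.factorial / (y / t) ^ N)) := by gcongr
    _ = _ := by rw [e, one_mul, div_pow]; field_simp

lemma integral_norm_besselMellin_le {ν : ℂ} (hν : 0 < ν.re) {y : ℝ} (hy : 0 < y) (N : ℕ) :
    ∫ t in Ioi (0 : ℝ), ‖(t : ℂ) ^ (ν - 1) • besselKernel y t‖ ≤
      N.factorial * Real.Gamma (ν.re + N) / y ^ N := by
  have ha : 0 < ν.re + N := by positivity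
  have hi : IntegrableOn (fun t : ℝ => t ^ (ν.re + N - 1) * Real.exp (-(1 * t))) (Ioi 0) := by
    refine (Real.GammaIntegral_convergent ha).congr_fun (fun t _ => ?_) measurableSet_Ioi
    rw [one_mul, mul_comm]
  have h := setIntegral_mono_on (besselKernel_mellinConvergent hy ν).norm
    (hi.const_mul (N.factorial / y ^ N)) measurableSet_Ioi
    fun t ht => norm_besselMellin_integrand_le hy ht N
  refine h.trans (le_of_eq ?_)
  rw [integral_const_mul, Real.integral_rpow_mul_exp_neg_mul_Ioi ha one_pos]
  simp
  ring

lemma hasSum_mul_besselMellin {ν : ℂ} (hν : 0 < ν.re) {y : ℝ} (hy : 0 < y) {b : ℕ+ → ℂ} {M : ℕ}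
    (hb : ∀ n, ‖b n‖ ≤ (n : ℝ) ^ M) :
    HasSum (fun n : ℕ+ => b n * besselMellin ν (n * y))
      (∫ t in Ioi (0 : ℝ), (t : ℂ) ^ (ν - 1) * Complex.exp (-t) *
        ∑' n : ℕ+, b n * Complex.exp (-(n * (y / t)))) := by
  have hny : ∀ n : ℕ+, 0 < (n : ℝ) * y := fun n => by positivity
  have key := hasSum_integral_of_summable_integral_norm (μ := volume.restrict (Ioi (0 : ℝ)))
    (F := fun (n : ℕ+) (t : ℝ) => b n * ((t : ℂ) ^ (ν - 1) • besselKernel (n * y) t))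
    (fun n => (besselKernel_mellinConvergent (hny n) ν).const_mul (b n)) ?_
  · have e : ∫ t in Ioi (0 : ℝ), ∑' n : ℕ+, b n * ((t : ℂ) ^ (ν - 1) • besselKernel (n * y) t) =
        ∫ t in Ioi (0 : ℝ), (t : ℂ) ^ (ν - 1) * Complex.exp (-t) *
        ∑' n : ℕ+, b n * Complex.exp (-(n * (y / t))) := by
      refine integral_congr_ae (.of_forall fun t => ?_)
      simp only
      rw [← tsum_mul_left]
      refine tsum_congr fun n => ?_
      rw [besselKernel, Complex.ofReal_exp, smul_eq_mul]
      push_cast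
      rw [neg_add, Complex.exp_add, mul_div_assoc]
      ring
    rw [e] at key
    refine key.congr_fun fun n => ?_
    rw [integral_const_mul]
    rfl
  -- The choice N = M + 2 in e^(-y/t) ≤ N!(t/y)^N beats the growth n^M by a factor n^(-2).
  · have hs : Summable fun n : ℕ+ => (1 / (n : ℝ) ^ 2) *
        ((M + 2).factorial * Real.Gamma (ν.re + (M + 2 : ℕ)) / y ^ (M + 2)) :=
      ((Real.summable_one_div_nat_pow.2 one_lt_two).comp_injective PNat.coe_injective).mul_right _
    refine Summable.of_nonneg_of_le (fun n => by positivity) (fun n => ?_) hs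
    simp only [norm_mul (b n)]
    rw [integral_const_mul]
    have hn : (0 : ℝ) < n := by positivity
    calc _ ≤ (n : ℝ) ^ M *
          ((M + 2).factorial * Real.Gamma (ν.re + (M + 2 : ℕ)) / (n * y) ^ (M + 2)) :=
          mul_le_mul (hb n) (integral_norm_besselMellin_le hν (hny n) (M + 2))
            (integral_nonneg fun t => norm_nonneg _) (by positivity)
      _ = _ := by
        rw [mul_pow, pow_add (n : ℝ)]
        field_simp

lemma besselWeight_eq (ν : ℂ) {a x : ℝ} (ha : 0 < a) (hx : 0 < x) (n : ℕ+) :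
    besselWeight ν a x n = ((a ^ 2 * x / 4 : ℝ) : ℂ) ^ (-(ν / 2)) / 2 *
      besselMellin ν (n * (a ^ 2 * x / 4)) := by
  set y : ℝ := a ^ 2 * x / 4 with hy
  have hy0 : 0 < y := by positivity
  have hn : (0 : ℝ) < n := by positivity
  have hw : 0 < Real.sqrt (n * y) := Real.sqrt_pos.2 (by positivity)
  have e : a * Real.sqrt (n * x) = 2 * Real.sqrt (n * y) := by
    have : (n : ℝ) * y = (a / 2) ^ 2 * (n * x) := by rw [hy]; ring
    rw [this, Real.sqrt_mul (sq_nonneg (a / 2)), Real.sqrt_sq (by positivity)]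
    ring
  have hp : ((Real.sqrt (n * y) : ℝ) : ℂ) ^ (-ν) =
      ((n : ℕ) : ℂ) ^ (-(ν / 2)) * (y : ℂ) ^ (-(ν / 2)) := by
    have h1 : ((n : ℕ) : ℂ) = ((n : ℝ) : ℂ) := by push_cast; rfl
    rw [h1, ← Complex.mul_cpow_ofReal_nonneg hn.le hy0.le, ← Complex.ofReal_mul]
    conv_rhs => rw [← Real.sq_sqrt (by positivity : 0 ≤ (n : ℝ) * y), sq, Complex.ofReal_mul,
      Complex.mul_cpow_ofReal_nonneg hw.le hw.le]
    rw [← Complex.cpow_add _ _ (by exact_mod_cast hw.ne')]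
    ring_nf
  have hnn : ((n : ℕ) : ℂ) ^ (ν / 2) * ((n : ℕ) : ℂ) ^ (-(ν / 2)) = 1 := by
    rw [← Complex.cpow_add _ _ (by simp)]
    simp
  rw [besselWeight, e, besselK_two_mul ν hw, Real.sq_sqrt (by positivity), hp]
  linear_combination ((y : ℂ) ^ (-(ν / 2)) * besselMellin ν (n * y) / 2) * hnn

lemma norm_sinDivisorSum_le (k : ℕ) (θ : ℝ) (n : ℕ+) :
    ‖sinDivisorSum k θ n‖ ≤ (n : ℝ) ^ (k + 1) := by
  calc ‖sinDivisorSum k θ n‖ ≤ ∑ d ∈ (n : ℕ).divisors, (n : ℝ) ^ k := by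
        refine norm_sum_le_of_le _ fun d hd => ?_
        have hdn : (d : ℝ) ≤ n := by exact_mod_cast Nat.divisor_le hd
        rw [norm_mul, norm_pow, Complex.norm_natCast, Complex.norm_real]
        calc (d : ℝ) ^ k * ‖Real.sin (2 * Real.pi * d * θ)‖ ≤ (d : ℝ) ^ k * 1 := by
              gcongr
              exact Real.abs_sin_le_one _
          _ ≤ (n : ℝ) ^ k := by rw [mul_one]; gcongr
    _ = ((n : ℕ).divisors.card : ℝ) * (n : ℝ) ^ k := by simp
    _ ≤ (n : ℝ) * (n : ℝ) ^ k := by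
        gcongr
        exact_mod_cast Nat.card_divisors_le_self n
    _ = _ := by ring

lemma strip_term_sub (k : ℕ) (θ T : ℝ) (m d : ℕ) :
    (d : ℂ) ^ k * Complex.exp (2 * Real.pi * Complex.I * (θ + m * (T * Complex.I))) ^ d -
      (d : ℂ) ^ k * Complex.exp (2 * Real.pi * Complex.I * ((-θ : ℝ) + m * (T * Complex.I))) ^ d =
    2 * Complex.I * ((d : ℂ) ^ k * (Real.sin (2 * Real.pi * d * θ) : ℂ) *
      Complex.exp (-((d * m : ℕ) * (2 * Real.pi * T)))) := by
  rw [← Complex.exp_nat_mul, ← Complex.exp_nat_mul]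
  have e1 : (d : ℂ) * (2 * Real.pi * Complex.I * (θ + m * (T * Complex.I))) =
      (2 * Real.pi * d * θ) * Complex.I + -((d * m : ℕ) * (2 * Real.pi * T)) := by
    push_cast
    linear_combination (d * 2 * Real.pi * m * T : ℂ) * Complex.I_sq
  have e2 : (d : ℂ) * (2 * Real.pi * Complex.I * ((-θ : ℝ) + m * (T * Complex.I))) =
      -(2 * Real.pi * d * θ) * Complex.I + -((d * m : ℕ) * (2 * Real.pi * T)) := by
    push_cast
    linear_combination (d * 2 * Real.pi * m * T : ℂ) * Complex.I_sq
  rw [e1, e2, Complex.exp_add, Complex.exp_add, Complex.ofReal_sin]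
  push_cast
  rw [Complex.sin]
  linear_combination (-(d : ℂ) ^ k * Complex.exp (-(d * m * (2 * Real.pi * T))) *
    (Complex.exp (-(2 * Real.pi * d * θ) * Complex.I) -
      Complex.exp (2 * Real.pi * d * θ * Complex.I))) * Complex.I_sq

/-- The difference between θ and -θ turns exponentials into 2i times sines; collecting pairs (d, m)
with dm = n gives the divisor sums. -/
lemma tsum_strip_eq (k : ℕ) (θ : ℝ) {T : ℝ} (hT : 0 < T) :
    ∑' m : ℕ+, (qSeries k (θ + m * (T * Complex.I)) -
        qSeries k ((-θ : ℝ) + m * (T * Complex.I))) =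
      2 * Complex.I * ∑' n : ℕ+, sinDivisorSum k θ n *
        Complex.exp (-((n : ℕ) * (2 * Real.pi * T))) := by
  set f : ℕ → ℕ → ℂ := fun d m => 2 * Complex.I * ((d : ℂ) ^ k *
    (Real.sin (2 * Real.pi * d * θ) : ℂ) * Complex.exp (-((d * m : ℕ) * (2 * Real.pi * T)))) with hf
  have h1 := ((hasSum_qSeries_strip k θ hT).sub (hasSum_qSeries_strip k (-θ) hT)).tsum_eq
  have h2 := ((summable_qSeries_strip k θ hT).hasSum.sub
    (summable_qSeries_strip k (-θ) hT).hasSum).congr_fun (g := fun p : ℕ+ × ℕ+ => f p.2 p.1)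
    fun p => (strip_term_sub k θ T p.1 p.2).symm
  have h3 := ((Equiv.prodComm ℕ+ ℕ+).hasSum_iff
    (f := fun p : ℕ+ × ℕ+ => f p.1 p.2)).1 h2
  rw [h1, ← h3.sum_divisors.tsum_eq, ← tsum_mul_left]
  refine tsum_congr fun n => ?_
  rw [sinDivisorSum, Finset.sum_mul, Finset.mul_sum]
  refine Finset.sum_congr rfl fun d hd => ?_
  simp only [hf]
  rw [Nat.mul_div_cancel' (Nat.dvd_of_mem_divisors hd)]

/-- Adjoining g to the family as one more index lets a single interchange theorem cover the whole
integrand, with no separate integrability proof for the infinite sum. -/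
lemma MeasureTheory.integral_add_tsum_of_summable_integral_norm {α ι : Type*} [MeasurableSpace α]
    {μ : Measure α} [Countable ι] {g : α → ℂ} {F : ι → α → ℂ} (hg : Integrable g μ)
    (hF : ∀ i, Integrable (F i) μ) (hs : Summable fun i => ∫ t, ‖F i t‖ ∂μ)
    (hF' : ∀ᵐ t ∂μ, Summable fun i => F i t) :
    ∫ t, (g t + ∑' i, F i t) ∂μ = ∫ t, g t ∂μ + ∑' i, ∫ t, F i t ∂μ := by
  have hF0 : ∀ i : Unit ⊕ ι, Integrable (Sum.elim (fun _ => g) F i) μ := by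
    rintro (_ | i)
    exacts [hg, hF i]
  have hs0 : Summable fun i : Unit ⊕ ι => ∫ t, ‖Sum.elim (fun _ => g) F i t‖ ∂μ :=
    Summable.sum _ Summable.of_finite hs
  have h := hasSum_integral_of_summable_integral_norm hF0 hs0
  have hsi : Summable fun i => ∫ t, F i t ∂μ :=
    hs.of_norm_bounded fun i => norm_integral_le_integral_norm _
  have h' : HasSum (fun i : Unit ⊕ ι => ∫ t, Sum.elim (fun _ => g) F i t ∂μ)
      (∫ t, g t ∂μ + ∑' i, ∫ t, F i t ∂μ) :=
    HasSum.sum (hasSum_unique _) hsi.hasSum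
  rw [← h.unique h']
  refine integral_congr_ae (hF'.mono fun t ht => ?_)
  exact (HasSum.sum (f := fun i : Unit ⊕ ι => Sum.elim (fun _ => g) F i t)
    (hasSum_unique _) ht.hasSum).tsum_eq.symm

lemma gammaIntegrand_integrable {s : ℂ} (hs : 0 < s.re) {r : ℝ} (hr : 0 < r) :
    IntegrableOn (fun t : ℝ => (t : ℂ) ^ (s - 1) * Complex.exp (-(r * t))) (Ioi 0) := by
  have h := (integrableOn_Ioi_comp_mul_left_iff
    (fun x : ℝ => Complex.exp (-x) * (x : ℂ) ^ (s - 1)) 0 hr).2 (by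
      simpa using Complex.GammaIntegral_convergent hs)
  refine IntegrableOn.congr_fun (h.const_mul (((r : ℂ) ^ (s - 1))⁻¹)) (fun t ht => ?_)
    measurableSet_Ioi
  have hrc : (r : ℂ) ^ (s - 1) ≠ 0 := by
    rw [Complex.cpow_ne_zero_iff]
    exact Or.inl (by exact_mod_cast hr.ne')
  rw [Complex.ofReal_mul, Complex.mul_cpow_ofReal_nonneg hr.le (le_of_lt ht)]
  field_simp

lemma integral_norm_gammaIntegrand {s : ℂ} (hs : 0 < s.re) {r : ℝ} (hr : 0 < r) :
    ∫ t in Ioi (0 : ℝ), ‖(t : ℂ) ^ (s - 1) * Complex.exp (-(r * t))‖ =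
      (1 / r) ^ s.re * Real.Gamma s.re := by
  rw [← Real.integral_rpow_mul_exp_neg_mul_Ioi hs hr]
  refine setIntegral_congr_fun measurableSet_Ioi fun t ht => ?_
  rw [norm_mul, Complex.norm_cpow_eq_rpow_re_of_pos ht, Complex.norm_exp]
  simp

/-! ### The dual series as a sum of Gamma integrals. -/

/-- The summand `d^k t^(ν+k) e^(-t) e^(-cd(j+θ)t)` whose integral is a term of the dual series. -/
noncomputable def dualIntegrand (k : ℕ) (ν : ℂ) (c θ : ℝ) (p : ℕ+ × ℕ) (t : ℝ) : ℂ :=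
  ((p.1 : ℕ) : ℂ) ^ k * ((t : ℂ) ^ ((ν + k + 1) - 1) *
    Complex.exp (-((1 + c * p.1 * (p.2 + θ) : ℝ) * t)))

section dual

variable {k : ℕ} {ν : ℂ} {c θ : ℝ}

lemma dualIntegrand_integrable (k : ℕ) (hν : 0 < ν.re) (hc : 0 < c) (hθ : 0 < θ) (p : ℕ+ × ℕ) :
    IntegrableOn (dualIntegrand k ν c θ p) (Ioi 0) := by
  have hs : 0 < (ν + k + 1).re := by
    simp
    positivity
  exact (gammaIntegrand_integrable hs (by positivity)).const_mul _

lemma summable_integral_norm_dualIntegrand (k : ℕ) (hν : 0 < ν.re) (hc : 0 < c) (hθ : 0 < θ) :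
    Summable fun p : ℕ+ × ℕ => ∫ t in Ioi (0 : ℝ), ‖dualIntegrand k ν c θ p t‖ := by
  have hs : 0 < (ν + k + 1).re := by
    simp
    positivity
  have hre : (ν + k + 1).re = (ν.re + 1) + k := by
    simp
    ring
  have h1 : Summable fun d : ℕ+ => 1 / ((d : ℕ) : ℝ) ^ (ν.re + 1) :=
    (Real.summable_one_div_nat_rpow.2 (by linarith)).comp_injective PNat.coe_injective
  have h2 : Summable fun j : ℕ => 1 / |(j : ℝ) + θ| ^ (ν + k + 1).re := by
    refine (Real.summable_one_div_nat_add_rpow _ _).2 ?_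
    rw [hre]
    linarith [Nat.cast_nonneg (α := ℝ) k]
  have h3 := (h1.mul_of_nonneg h2 (fun _ => by positivity) fun _ => by positivity).mul_left
    (Real.Gamma (ν + k + 1).re / c ^ (ν + k + 1).re)
  refine Summable.of_nonneg_of_le (fun p => integral_nonneg fun t => norm_nonneg _)
    (fun p => ?_) h3
  have hd : (0 : ℝ) < (p.1 : ℕ) := by exact_mod_cast p.1.pos
  have hj : (0 : ℝ) < p.2 + θ := by positivity
  have hr : 0 < 1 + c * (p.1 : ℕ) * (p.2 + θ) := by positivity
  have e : ∀ t : ℝ, ‖dualIntegrand k ν c θ p t‖ = ((p.1 : ℕ) : ℝ) ^ k *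
      ‖(t : ℂ) ^ ((ν + k + 1) - 1) *
        Complex.exp (-((1 + c * (p.1 : ℕ) * (p.2 + θ) : ℝ) * t))‖ := fun t => by
    rw [dualIntegrand, norm_mul, norm_pow, Complex.norm_natCast]
  simp only [e]
  rw [integral_const_mul, integral_norm_gammaIntegrand hs hr, abs_of_pos hj]
  -- Dropping the 1 separates the variables; d^k is absorbed, leaving exponent Re ν + 1 in d and Re
  -- ν + k + 1 in j + θ, both above 1.
  have hle : (1 / (1 + c * (p.1 : ℕ) * (p.2 + θ))) ^ (ν + k + 1).re ≤
      (1 / (c * (p.1 : ℕ) * (p.2 + θ))) ^ (ν + k + 1).re := by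
    refine Real.rpow_le_rpow (by positivity) ?_ hs.le
    exact one_div_le_one_div_of_le (by positivity) (by linarith)
  have hG := Real.Gamma_pos_of_pos hs
  calc _ ≤ ((p.1 : ℕ) : ℝ) ^ k * ((1 / (c * (p.1 : ℕ) * (p.2 + θ))) ^ (ν + k + 1).re *
        Real.Gamma (ν + k + 1).re) := by gcongr
    _ = _ := by
      rw [one_div, Real.inv_rpow (by positivity), Real.mul_rpow (by positivity) hj.le,
        Real.mul_rpow hc.le hd.le]
      have : ((p.1 : ℕ) : ℝ) ^ (ν + k + 1).re = ((p.1 : ℕ) : ℝ) ^ (ν.re + 1) * ((p.1 : ℕ) : ℝ) ^ k := by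
        rw [hre, Real.rpow_add hd, Real.rpow_natCast]
      rw [this]
      have := Real.rpow_pos_of_pos hc (ν + k + 1).re
      have := Real.rpow_pos_of_pos hd (ν.re + 1)
      have := Real.rpow_pos_of_pos hj (ν + k + 1).re
      field_simp

lemma integral_dualIntegrand (k : ℕ) (hν : 0 < ν.re) {a x : ℝ} (ha : 0 < a) (hx : 0 < x)
    (hθ : 0 < θ) (p : ℕ+ × ℕ) :
    ∫ t in Ioi (0 : ℝ), dualIntegrand k ν (16 * Real.pi ^ 2 / (a ^ 2 * x)) θ p t =
      ((p.1 : ℕ) : ℂ) ^ k * gammaQuot k ν a x p.1 (p.2 + θ) := by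
  have hs : 0 < (ν + k + 1).re := by
    simp
    positivity
  have hpi := Real.pi_pos
  have hr : 0 < 1 + 16 * Real.pi ^ 2 / (a ^ 2 * x) * (p.1 : ℕ) * (p.2 + θ) := by positivity
  simp only [dualIntegrand]
  rw [integral_const_mul, Complex.integral_cpow_mul_exp_neg_mul_Ioi hs hr, gammaQuot]
  congr 1
  have e : 1 + 16 * Real.pi ^ 2 * (p.1 : ℕ) / (a ^ 2 * x) * (p.2 + θ) =
    1 + 16 * Real.pi ^ 2 / (a ^ 2 * x) * (p.1 : ℕ) * (p.2 + θ) := by ring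
  have e2 : 1 + ν + k = ν + k + 1 := by ring
  rw [e, e2, one_div, Complex.inv_cpow _ _ (by
    rw [Complex.arg_ofReal_of_nonneg hr.le]; exact Real.pi_pos.ne)]
  ring

end dual

lemma cexp_ray_pow (θ : ℝ) {y t : ℝ} (hy : 0 < y) (ht : 0 < t) (d j : ℕ) :
    Complex.exp (2 * Real.pi * Complex.I *
        (Complex.I * ((j + θ) / (y / (2 * Real.pi * t) : ℝ)))) ^ d =
      Complex.exp (-((4 * Real.pi ^ 2 / y * d * (j + θ) * t : ℝ) : ℂ)) := by
  rw [← Complex.exp_nat_mul]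
  congr 1
  have hpi := Real.pi_pos
  have h1 : (y : ℂ) ≠ 0 := by exact_mod_cast hy.ne'
  have h2 : (t : ℂ) ≠ 0 := by exact_mod_cast ht.ne'
  have h3 : (Real.pi : ℂ) ≠ 0 := by exact_mod_cast hpi.ne'
  push_cast
  field_simp
  rw [Complex.I_sq]
  ring

lemma dualIntegrand_eq (k : ℕ) (ν : ℂ) (c θ : ℝ) (p : ℕ+ × ℕ) {t : ℝ} (ht : 0 < t) :
    dualIntegrand k ν c θ p t = (t : ℂ) ^ (ν - 1) * Complex.exp (-t) * (t : ℂ) ^ (k + 1) *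
      (((p.1 : ℕ) : ℂ) ^ k * Complex.exp (-((c * p.1 * (p.2 + θ) * t : ℝ) : ℂ))) := by
  have h2 : (t : ℂ) ≠ 0 := by exact_mod_cast ht.ne'
  have e1 : (ν + k + 1) - 1 = (ν - 1) + ((k + 1 : ℕ) : ℂ) := by push_cast; ring
  have e2 : -(((1 + c * p.1 * (p.2 + θ) : ℝ) : ℂ) * t) =
    -t + -((c * p.1 * (p.2 + θ) * t : ℝ) : ℂ) := by push_cast; ring
  rw [dualIntegrand, e1, e2, Complex.cpow_add _ _ h2, Complex.cpow_natCast, Complex.exp_add]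
  ring

lemma summable_ray_exp (k : ℕ) {θ y t : ℝ} (hθ : 0 < θ) (hy : 0 < y) (ht : 0 < t) :
    Summable fun p : ℕ+ × ℕ => ((p.1 : ℕ) : ℂ) ^ k *
      Complex.exp (-((4 * Real.pi ^ 2 / y * (p.1 : ℕ) * (p.2 + θ) * t : ℝ) : ℂ)) := by
  have hpi := Real.pi_pos
  refine (summable_qSeries_ray k hθ (by positivity : 0 < y / (2 * Real.pi * t))).congr fun p => ?_
  rw [cexp_ray_pow θ hy ht]

lemma tsum_ray_eq (k : ℕ) {θ y t : ℝ} (h0 : 0 < θ) (h1 : θ < 1) (hy : 0 < y) (ht : 0 < t) :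
    ∑' j : ℕ, (qSeries k (Complex.I * ((j + θ) / (y / (2 * Real.pi * t) : ℝ))) -
        qSeries k (Complex.I * ((j + (1 - θ : ℝ)) / (y / (2 * Real.pi * t) : ℝ)))) =
      ∑' p : ℕ+ × ℕ, (((p.1 : ℕ) : ℂ) ^ k *
          Complex.exp (-((4 * Real.pi ^ 2 / y * (p.1 : ℕ) * (p.2 + θ) * t : ℝ) : ℂ)) -
        ((p.1 : ℕ) : ℂ) ^ k *
          Complex.exp (-((4 * Real.pi ^ 2 / y * (p.1 : ℕ) * (p.2 + (1 - θ)) * t : ℝ) : ℂ))) := by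
  have hpi := Real.pi_pos
  have hT : 0 < y / (2 * Real.pi * t) := by positivity
  have h1' : 0 < 1 - θ := by linarith
  rw [((hasSum_qSeries_ray k h0 hT).sub (hasSum_qSeries_ray k h1' hT)).tsum_eq,
    (summable_ray_exp k h0 hy ht).tsum_sub (summable_ray_exp k h1' hy ht)]
  simp only [cexp_ray_pow _ hy ht]

/-! ### The trigonometric identity. -/

lemma sinDivisorSum_series_transform {k : ℕ} (hk : Even k) {θ y t : ℝ} (h0 : 0 < θ) (h1 : θ < 1)
    (hy : 0 < y) (ht : 0 < t) :
    lipschitzConst k * (2 * Complex.I) *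
        ∑' n : ℕ+, sinDivisorSum k θ n * Complex.exp (-(n * (y / t))) =
      deltaK k * (2 * Real.pi ^ 2 / y) * hurwitzDiff θ 0 * t - hurwitzDiff θ (1 + k) -
      lipschitzConst k * (2 * Real.pi / (y * Complex.I)) ^ (k + 1) * (t : ℂ) ^ (k + 1) *
        ∑' p : ℕ+ × ℕ, (((p.1 : ℕ) : ℂ) ^ k *
          Complex.exp (-((4 * Real.pi ^ 2 / y * (p.1 : ℕ) * (p.2 + θ) * t : ℝ) : ℂ)) -
        ((p.1 : ℕ) : ℂ) ^ k *
          Complex.exp (-((4 * Real.pi ^ 2 / y * (p.1 : ℕ) * (p.2 + (1 - θ)) * t : ℝ) : ℂ))) := by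
  have hpi := Real.pi_pos
  -- The lattice parameter T = y/(2πt) makes e^(-2πTn) equal to e^(-ny/t).
  have hT : 0 < y / (2 * Real.pi * t) := by positivity
  have h := modularDefect_eq hk h0 h1 hT
  have c1 : (y : ℂ) ≠ 0 := by exact_mod_cast hy.ne'
  have c2 : (t : ℂ) ≠ 0 := by exact_mod_cast ht.ne'
  have c3 : (Real.pi : ℂ) ≠ 0 := by exact_mod_cast hpi.ne'
  rw [modularDefect, tsum_strip_eq k θ hT, tsum_ray_eq k h0 h1 hy ht] at h
  have e1 : (2 * Real.pi * (y / (2 * Real.pi * t) : ℝ) : ℂ) = y / t := by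
    push_cast
    field_simp
  have e2 : ((((y / (2 * Real.pi * t) : ℝ) : ℂ) * Complex.I) ^ (k + 1))⁻¹ =
      (2 * Real.pi / (y * Complex.I)) ^ (k + 1) * (t : ℂ) ^ (k + 1) := by
    rw [← mul_pow, ← inv_pow]
    congr 1
    push_cast
    have := Complex.I_ne_zero
    field_simp
  have e3 : (Real.pi : ℂ) / (y / (2 * Real.pi * t) : ℝ) = 2 * Real.pi ^ 2 / y * t := by
    push_cast
    field_simp
  rw [e1, e2, e3] at h
  linear_combination h

/-- Under t^(ν-1) e^(-t) dt the three parts of the transformed series, proportional to t, to 1 and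
to t^(k+1) e^(-ct), give Γ(ν+1), Γ(ν) and the quotients Γ(ν+k+1)/(1+c)^(ν+k+1). -/
lemma integral_sinDivisorSum_series {k : ℕ} (hk : Even k) {ν : ℂ} (hν : 0 < ν.re) {a x θ : ℝ}
    (ha : 0 < a) (hx : 0 < x) (h0 : 0 < θ) (h1 : θ < 1) :
    lipschitzConst k * (2 * Complex.I) * ∫ t in Ioi (0 : ℝ), (t : ℂ) ^ (ν - 1) * Complex.exp (-t) *
        ∑' n : ℕ+, sinDivisorSum k θ n * Complex.exp (-(n * ((a ^ 2 * x / 4 : ℝ) / t))) =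
      deltaK k * (2 * Real.pi ^ 2 / (a ^ 2 * x / 4 : ℝ)) * hurwitzDiff θ 0 * Complex.Gamma (ν + 1) -
      hurwitzDiff θ (1 + k) * Complex.Gamma ν -
      lipschitzConst k * (2 * Real.pi / ((a ^ 2 * x / 4 : ℝ) * Complex.I)) ^ (k + 1) *
        ∑' p : ℕ+ × ℕ, ((p.1 : ℕ) : ℂ) ^ k *
          (gammaQuot k ν a x p.1 (p.2 + θ) - gammaQuot k ν a x p.1 (p.2 + 1 - θ)) := by
  set y : ℝ := a ^ 2 * x / 4 with hyd
  have hy : 0 < y := by positivity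
  have hpi := Real.pi_pos
  have h1' : 0 < 1 - θ := by linarith
  have hc : 4 * Real.pi ^ 2 / y = 16 * Real.pi ^ 2 / (a ^ 2 * x) := by
    rw [hyd]
    field_simp
    norm_num
  have hc0 : 0 < 16 * Real.pi ^ 2 / (a ^ 2 * x) := by positivity
  have hν1 : 0 < (ν + 1).re := by
    simp
    positivity
  set D := dualIntegrand k ν (16 * Real.pi ^ 2 / (a ^ 2 * x)) with hD
  set C := lipschitzConst k * (2 * Real.pi / (y * Complex.I)) ^ (k + 1) with hC
  set B := deltaK k * (2 * Real.pi ^ 2 / y) * hurwitzDiff θ 0 with hB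
  have i0 := dualIntegrand_integrable k hν hc0 h0
  have i1 := dualIntegrand_integrable k hν hc0 h1'
  have hgi : ∀ {s : ℂ}, 0 < s.re →
      IntegrableOn (fun t : ℝ => (t : ℂ) ^ (s - 1) * Complex.exp (-t)) (Ioi 0) := fun hs => by
    simpa using gammaIntegrand_integrable hs one_pos
  have hgv : ∀ {s : ℂ}, 0 < s.re →
      ∫ t in Ioi (0 : ℝ), (t : ℂ) ^ (s - 1) * Complex.exp (-t) = Complex.Gamma s := fun hs => by
    simpa using Complex.integral_cpow_mul_exp_neg_mul_Ioi hs one_pos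
  have key := integral_add_tsum_of_summable_integral_norm (μ := volume.restrict (Ioi (0 : ℝ)))
    (g := fun t => B * ((t : ℂ) ^ ((ν + 1) - 1) * Complex.exp (-t)) -
      hurwitzDiff θ (1 + k) * ((t : ℂ) ^ (ν - 1) * Complex.exp (-t)))
    (F := fun p t => -C * (D θ p t - D (1 - θ) p t))
    (((hgi hν1).const_mul B).sub ((hgi hν).const_mul _))
    (fun p => ((i0 p).sub (i1 p)).const_mul _) ?_ ?_
  · rw [← integral_const_mul]
    have e : ∀ t ∈ Ioi (0 : ℝ), lipschitzConst k * (2 * Complex.I) *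
        ((t : ℂ) ^ (ν - 1) * Complex.exp (-t) *
        ∑' n : ℕ+, sinDivisorSum k θ n * Complex.exp (-(n * (y / t)))) =
        B * ((t : ℂ) ^ ((ν + 1) - 1) * Complex.exp (-t)) -
        hurwitzDiff θ (1 + k) * ((t : ℂ) ^ (ν - 1) * Complex.exp (-t)) +
        ∑' p, -C * (D θ p t - D (1 - θ) p t) := fun t ht => by
      have hF := sinDivisorSum_series_transform hk h0 h1 hy ht
      have hp : (t : ℂ) ^ ((ν + 1) - 1) = (t : ℂ) ^ (ν - 1) * t := by
        rw [add_sub_right_comm, Complex.cpow_add _ _ (by exact_mod_cast (ne_of_gt ht)),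
          Complex.cpow_one]
      rw [tsum_mul_left]
      simp only [hD, dualIntegrand_eq k ν _ _ _ ht, ← mul_sub]
      rw [tsum_mul_left, hp, ← hc]
      simp only [← mul_sub] at hF
      linear_combination ((t : ℂ) ^ (ν - 1) * Complex.exp (-t)) * hF
    rw [setIntegral_congr_fun measurableSet_Ioi e, key, integral_sub ((hgi hν1).const_mul B)
      ((hgi hν).const_mul _), integral_const_mul, integral_const_mul, hgv hν1, hgv hν,
      sub_eq_add_neg _ (C * _), ← neg_mul C, ← tsum_mul_left]
    congr 1
    refine tsum_congr fun p => ?_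
    rw [integral_const_mul, integral_sub (i0 p) (i1 p), integral_dualIntegrand k hν ha hx h0,
      integral_dualIntegrand k hν ha hx h1', ← mul_sub, add_sub_assoc]
  · have s0 := summable_integral_norm_dualIntegrand k hν hc0 h0
    have s1 := summable_integral_norm_dualIntegrand k hν hc0 h1'
    refine Summable.of_nonneg_of_le (fun p => integral_nonneg fun t => norm_nonneg _)
      (fun p => ?_) ((s0.add s1).mul_left ‖-C‖)
    simp only [norm_mul (-C)]
    rw [integral_const_mul, ← integral_add (i0 p).norm (i1 p).norm]
    refine mul_le_mul_of_nonneg_left ?_ (norm_nonneg _)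
    exact integral_mono ((i0 p).sub (i1 p)).norm ((i0 p).norm.add (i1 p).norm)
      fun t => norm_sub_le _ _
  · filter_upwards [ae_restrict_mem measurableSet_Ioi] with t ht
    have hs : ∀ {η : ℝ}, 0 < η → Summable fun p => D η p t := fun hη => by
      simp only [hD, dualIntegrand_eq k ν _ _ _ ht, ← hc]
      exact (summable_ray_exp k hη hy ht).mul_left _
    exact ((hs h0).sub (hs h1')).mul_left _

lemma summable_pow_mul_gammaQuot (k : ℕ) {ν : ℂ} (hν : 0 < ν.re) {a x θ : ℝ}
    (ha : 0 < a) (hx : 0 < x) (h0 : 0 < θ) :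
    Summable fun p : ℕ+ × ℕ => ((p.1 : ℕ) : ℂ) ^ k * gammaQuot k ν a x p.1 (p.2 + θ) := by
  have hpi := Real.pi_pos
  have hc0 : 0 < 16 * Real.pi ^ 2 / (a ^ 2 * x) := by positivity
  refine Summable.of_norm_bounded (summable_integral_norm_dualIntegrand k hν hc0 h0) fun p => ?_
  rw [← integral_dualIntegrand k hν ha hx h0]
  exact norm_integral_le_integral_norm _

theorem trigIdentity {k : ℕ} (hk : Even k) {ν : ℂ} (hν : 0 < ν.re) {a x θ : ℝ}
    (ha : 0 < a) (hx : 0 < x) (h0 : 0 < θ) (h1 : θ < 1) : TrigIdentity k ν a x θ := by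
  have h1' : 0 < 1 - θ := by linarith
  have hS : Summable (fun p : ℕ+ × ℕ => ((p.1 : ℕ) : ℂ) ^ k *
      (gammaQuot k ν a x p.1 (p.2 + θ) - gammaQuot k ν a x p.1 (p.2 + 1 - θ))) := by
    refine ((summable_pow_mul_gammaQuot k hν ha hx h0).sub
      (summable_pow_mul_gammaQuot k hν ha hx h1')).congr fun p => ?_
    rw [← mul_sub, add_sub_assoc]
  have hy : 0 < a ^ 2 * x / 4 := by positivity
  have hK := hasSum_mul_besselMellin hν hy (norm_sinDivisorSum_le k θ)
  have hK' := (hK.mul_left (((a ^ 2 * x / 4 : ℝ) : ℂ) ^ (-(ν / 2)) / 2)).congr_fun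
    (g := fun n : ℕ+ => besselWeight ν a x n * sinDivisorSum k θ n) fun n => by
      rw [besselWeight_eq ν ha hx]
      ring
  refine ⟨hK'.summable, hS, ?_⟩
  have hI := integral_sinDivisorSum_series hk hν ha hx h0 h1
  rw [hK'.tsum_eq]
  have hit : ∑' d : ℕ+, ((d : ℕ) : ℂ) ^ k * ∑' m : ℕ,
      (gammaQuot k ν a x d (m + θ) - gammaQuot k ν a x d (m + 1 - θ)) =
      ∑' p : ℕ+ × ℕ, ((p.1 : ℕ) : ℂ) ^ k *
        (gammaQuot k ν a x p.1 (p.2 + θ) - gammaQuot k ν a x p.1 (p.2 + 1 - θ)) := by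
    rw [hS.tsum_prod]
    simp only [tsum_mul_left]
  rw [hit]
  set S := ∑' p : ℕ+ × ℕ, ((p.1 : ℕ) : ℂ) ^ k *
    (gammaQuot k ν a x p.1 (p.2 + θ) - gammaQuot k ν a x p.1 (p.2 + 1 - θ))
  set J := ∫ t in Ioi (0 : ℝ), (t : ℂ) ^ (ν - 1) * Complex.exp (-t) *
        ∑' n : ℕ+, sinDivisorSum k θ n * Complex.exp (-(n * ((a ^ 2 * x / 4 : ℝ) / t)))
  have hyc : ((a ^ 2 * x / 4 : ℝ) : ℂ) ≠ 0 := by exact_mod_cast hy.ne'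
  have hpow : ((a ^ 2 * x / 4 : ℝ) : ℂ) ^ (ν / 2 + k + 1) *
      ((a ^ 2 * x / 4 : ℝ) : ℂ) ^ (-(ν / 2)) = (a ^ 2 * x / 4 : ℂ) ^ (k + 1) := by
    rw [← Complex.cpow_add _ _ hyc]
    have : ν / 2 + k + 1 + -(ν / 2) = ((k + 1 : ℕ) : ℂ) := by push_cast; ring
    rw [this, Complex.cpow_natCast]
    push_cast
    rfl
  have hlhs : ((a ^ 2 * x / 4 : ℝ) : ℂ) ^ (ν / 2 + k + 1) *
      (((a ^ 2 * x / 4 : ℝ) : ℂ) ^ (-(ν / 2)) / 2 * J) = (a ^ 2 * x / 4 : ℂ) ^ (k + 1) / 2 * J := by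
    rw [← hpow]
    ring
  rw [hlhs, add_comm 1 ν]
  have ca : (a : ℂ) ≠ 0 := by exact_mod_cast ha.ne'
  have cx : (x : ℂ) ≠ 0 := by exact_mod_cast hx.ne'
  have cp : (Real.pi : ℂ) ≠ 0 := by exact_mod_cast Real.pi_ne_zero
  have cf : (k.factorial : ℂ) ≠ 0 := by exact_mod_cast k.factorial_ne_zero
  obtain ⟨j, rfl⟩ := hk
  rw [← two_mul] at *
  have hI2 : Complex.I ^ (2 * j + 1) = (-1) ^ j * Complex.I := by
    rw [pow_succ, pow_mul, Complex.I_sq]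
  have hdiv : 2 * j / 2 = j := by omega
  have hl : lipschitzConst (2 * j) =
      -((2 * Real.pi) ^ (2 * j + 1) * ((-1) ^ j * Complex.I)) / (2 * j).factorial := by
    rw [lipschitzConst, ← hI2]
    rw [show (-2 * Real.pi * Complex.I : ℂ) = -1 * (2 * Real.pi * Complex.I) by ring, mul_pow,
      Odd.neg_one_pow ⟨j, rfl⟩, mul_pow]
    ring
  have hs : ((-1 : ℂ) ^ j) ^ 2 = 1 := by
    rw [← pow_mul, mul_comm, pow_mul]
    simp
  have hs0 : ((-1 : ℂ) ^ j) ≠ 0 := by simp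
  have hlI : lipschitzConst (2 * j) * (2 * Complex.I) =
      2 * (2 * Real.pi) ^ (2 * j + 1) * (-1) ^ j / (2 * j).factorial := by
    rw [hl]
    linear_combination (-2 * (2 * Real.pi) ^ (2 * j + 1) * (-1) ^ j / (2 * j).factorial : ℂ) *
      Complex.I_sq
  have hR : lipschitzConst (2 * j) *
      (2 * Real.pi / ((a ^ 2 * x / 4 : ℝ) * Complex.I)) ^ (2 * j + 1) =
      -((2 * Real.pi) ^ (2 * j + 1)) ^ 2 / ((a ^ 2 * x / 4) ^ (2 * j + 1) * (2 * j).factorial) := by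
    have := Complex.I_ne_zero
    rw [hl, div_pow, mul_pow _ Complex.I, hI2]
    push_cast
    field_simp
  have hQ : (a : ℂ) ^ (2 * (2 * j) + 2) * (x : ℂ) ^ (2 * j + 1) =
      (a ^ 2 * x / 4) ^ (2 * j + 1) / 4 * 2 ^ (2 * (2 * j) + 4) := by
    have e1 : (2 : ℂ) ^ (2 * (2 * j) + 4) = 4 ^ (2 * j + 1) * 4 := by
      rw [show (4 : ℂ) = 2 ^ 2 by norm_num, ← pow_mul, ← pow_add]
      ring_nf
    rw [e1, div_pow, mul_pow, ← pow_mul, mul_add, mul_one]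
    field_simp
  -- Only k = 0 matters here, where the power of y cancels the denominator y.
  have hd : deltaK (2 * j) * ((a ^ 2 * x / 4 : ℂ) ^ (2 * j + 1) * (2 * j).factorial * (-1) ^ j /
      ((2 * Real.pi) ^ (2 * j + 1) * (a ^ 2 * x / 4 : ℝ))) = deltaK (2 * j) / (2 * Real.pi) := by
    rcases eq_or_ne j 0 with rfl | hj
    · push_cast
      simp
      field_simp
    · simp [deltaK, hj]
  have hP : ((2 * Real.pi : ℂ) ^ (2 * j + 1)) ≠ 0 := pow_ne_zero _ (mul_ne_zero two_ne_zero cp)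
  have hY : ((a ^ 2 * x / 4 : ℂ) ^ (2 * j + 1)) ≠ 0 := by
    refine pow_ne_zero _ ?_
    have := mul_ne_zero (pow_ne_zero 2 ca) cx
    simpa using this
  have hZ : -((-1 : ℂ) ^ j * (a : ℂ) ^ (2 * (2 * j) + 2) * ((2 * j).factorial : ℂ) /
      (2 ^ (2 * (2 * j) + 4) * (2 * (Real.pi : ℂ)) ^ (2 * j + 1))) * Complex.Gamma ν *
      hurwitzDiff θ (1 + (2 * j : ℕ)) * (x : ℂ) ^ (2 * j + 1) =
      -((-1) ^ j * ((a ^ 2 * x / 4) ^ (2 * j + 1) / 4) * (2 * j).factorial /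
        (2 * Real.pi) ^ (2 * j + 1)) * Complex.Gamma ν * hurwitzDiff θ (1 + (2 * j : ℕ)) := by
    have h2 : (2 : ℂ) ^ (2 * (2 * j) + 4) ≠ 0 := by simp
    field_simp
    linear_combination (-4 * Complex.Gamma ν * hurwitzDiff θ (1 + (2 * j : ℕ)) : ℂ) * hQ
  rw [hlI, hR] at hI
  rw [hdiv, hZ]
  generalize ((-1 : ℂ) ^ j) = ε at *
  generalize (a ^ 2 * x / 4 : ℂ) ^ (2 * j + 1) = Y at *
  generalize (2 * Real.pi : ℂ) ^ (2 * j + 1) = P at *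
  generalize ((2 * j).factorial : ℂ) = f at *
  generalize (((a ^ 2 * x / 4 : ℝ) : ℂ)) = y at *
  -- With the powers named, the claim is the integral identity `hI` multiplied by Yfε/(4P); ε² = 1
  -- absorbs the sign.
  have h1 : Y / 2 * J = (Y * f * ε / (4 * P)) * (2 * P * ε / f * J) := by
    field_simp
    linear_combination (-4 * J) * hs
  have h2 : ε / 4 * P * S = -(Y * f * ε / (4 * P)) * (-P ^ 2 / (Y * f) * S) := by
    field_simp
  have h3 : deltaK (2 * j) * (Real.pi * Complex.Gamma (ν + 1) / 4) * hurwitzDiff θ 0 =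
      (Y * f * ε / (4 * P)) * (deltaK (2 * j) * (2 * Real.pi ^ 2 / y) * hurwitzDiff θ 0 *
        Complex.Gamma (ν + 1)) := by
    have : deltaK (2 * j) * Real.pi =
        2 * Real.pi ^ 2 * (deltaK (2 * j) * (Y * f * ε / (P * y))) := by
      rw [hd]
      field_simp
    linear_combination (Complex.Gamma (ν + 1) / 4 * hurwitzDiff θ 0) * this
  rw [h1, h2, h3, hI]
  ring

/-! ### Odd primitive characters: sine expansion, L-values and divisor sums. -/

lemma ZMod.LFunction_const_mul {q : ℕ} [NeZero q] (c : ℂ) (Φ : ZMod q → ℂ) (s : ℂ) :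
    ZMod.LFunction (fun j => c * Φ j) s = c * ZMod.LFunction Φ s := by
  simp only [ZMod.LFunction, mul_assoc, ← Finset.mul_sum]
  ring

lemma gammaQuot_div_eq (k : ℕ) (ν : ℂ) {a x : ℝ} {q : ℕ} (d r : ℕ+) :
    gammaQuot k ν a x d ((r : ℕ) / q) = Complex.Gamma (ν + k + 1) /
      ((16 * Real.pi ^ 2 / (a ^ 2 * q) * (((d : ℕ) * (r : ℕ) : ℕ) / x) + 1 : ℝ) : ℂ) ^
        (ν + k + 1) := by
  have e : 1 + 16 * Real.pi ^ 2 * (d : ℕ) / (a ^ 2 * x) * (((r : ℕ) : ℝ) / q) =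
      16 * Real.pi ^ 2 / (a ^ 2 * q) * (((d : ℕ) * (r : ℕ) : ℕ) / x) + 1 := by
    push_cast
    simp only [div_eq_mul_inv, mul_inv]
    ring
  rw [gammaQuot, e, show 1 + ν + k = ν + k + 1 by ring]

namespace DirichletCharacter

variable {q : ℕ} {χ : DirichletCharacter ℂ q}

lemma Odd.apply_zero (hχ : χ.Odd) : χ 0 = 0 := by
  have h := Odd.eval_neg χ 0 hχ
  rw [neg_zero] at h
  exact self_eq_neg.1 h

lemma Odd.inv (hχ : χ.Odd) : χ⁻¹.Odd := by
  rw [DirichletCharacter.Odd, MulChar.inv_apply_eq_inv, show χ (-1) = -1 from hχ]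
  simp

variable [NeZero q]

lemma Odd.sum_mul_neg (hχ : χ.Odd) (f : ZMod q → ℂ) :
    ∑ h, χ h * f (-h) = -∑ h, χ h * f h := by
  rw [← Finset.sum_neg_distrib, ← Equiv.sum_comp (Equiv.neg (ZMod q))]
  refine Finset.sum_congr rfl fun h _ => ?_
  rw [Equiv.neg_apply, Odd.eval_neg χ h hχ, neg_neg, neg_mul]

lemma stdAddChar_mul_natCast (h : ZMod q) (d : ℕ) :
    ZMod.stdAddChar (h * (d : ZMod q)) = Complex.exp ((2 * Real.pi * d * (h.val / q : ℝ) : ℝ) * Complex.I) := by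
  have e : h * (d : ZMod q) = (((h.val * d : ℕ) : ℤ) : ZMod q) := by simp
  rw [e, ZMod.stdAddChar_coe]
  congr 1
  push_cast
  ring

lemma Odd.sum_mul_stdAddChar (hχ : χ.Odd) (d : ℕ) :
    ∑ h, χ h * ZMod.stdAddChar (h * (d : ZMod q)) =
      Complex.I * ∑ h, χ h * (Real.sin (2 * Real.pi * d * (h.val / q : ℝ)) : ℂ) := by
  have h1 := hχ.sum_mul_neg fun h => ZMod.stdAddChar (h * (d : ZMod q))
  have h2 : ∀ h : ZMod q, Complex.I * (χ h * (Real.sin (2 * Real.pi * d * (h.val / q : ℝ)) : ℂ)) =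
      (1 / 2) * (χ h * ZMod.stdAddChar (h * (d : ZMod q))) -
        (1 / 2) * (χ h * ZMod.stdAddChar (-h * (d : ZMod q))) := fun h => by
    rw [neg_mul, AddChar.map_neg_eq_inv, stdAddChar_mul_natCast, ← Complex.exp_neg,
      Complex.ofReal_sin, Complex.sin, neg_mul]
    linear_combination (χ h / 2 *
      (Complex.exp (-(((2 * Real.pi * d * (h.val / q : ℝ) : ℝ) : ℂ) * Complex.I)) -
        Complex.exp (((2 * Real.pi * d * (h.val / q : ℝ) : ℝ) : ℂ) * Complex.I))) * Complex.I_sq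
  rw [Finset.mul_sum, Finset.sum_congr rfl fun h _ => h2 h, Finset.sum_sub_distrib,
    ← Finset.mul_sum, ← Finset.mul_sum, h1]
  ring

lemma IsPrimitive.dft_eq_of_odd (hp : χ.IsPrimitive) (hχ : χ.Odd) :
    ZMod.dft χ = fun h => -gaussSum χ ZMod.stdAddChar * χ⁻¹ h := by
  ext h
  rw [hp.fourierTransform_eq_inv_mul_gaussSum, Odd.eval_neg _ _ hχ.inv]
  ring

/-- Fourier inversion on ℤ/q: the transform of χ is a Gauss sum times χ̄, and oddness keeps only the
sine part of the second transform. -/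
lemma IsPrimitive.apply_eq_sum_sin (hp : χ.IsPrimitive) (hχ : χ.Odd) (d : ℕ) :
    χ d = -(Complex.I * gaussSum χ ZMod.stdAddChar / q) *
      ∑ h, χ⁻¹ h * (Real.sin (2 * Real.pi * d * (h.val / q : ℝ)) : ℂ) := by
  have hq : (q : ℂ) ≠ 0 := by exact_mod_cast NeZero.ne q
  have h1 := congr_fun (ZMod.dft_dft (χ : ZMod q → ℂ)) (-d)
  rw [hp.dft_eq_of_odd hχ, ZMod.dft_apply] at h1
  have h2 : ∀ j : ZMod q, ZMod.stdAddChar (-(j * -(d : ZMod q))) •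
      (-gaussSum χ ZMod.stdAddChar * χ⁻¹ j) =
      -gaussSum χ ZMod.stdAddChar * (χ⁻¹ j * ZMod.stdAddChar (j * (d : ZMod q))) := fun j => by
    rw [mul_neg, neg_neg, smul_eq_mul]
    ring
  rw [Finset.sum_congr rfl fun j _ => h2 j, ← Finset.mul_sum, hχ.inv.sum_mul_stdAddChar,
    neg_neg, smul_eq_mul] at h1
  rw [neg_mul, div_mul_eq_mul_div, ← neg_div, eq_div_iff hq]
  linear_combination -h1

/-- The functional equation at s = 1, applied to the discrete Fourier transform of χ, relates L(0,
χ̄) to L(1, χ). -/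
lemma IsPrimitive.LFunction_one_of_odd (hp : χ.IsPrimitive) (hχ : χ.Odd) :
    LFunction χ 1 = -(Complex.I * Real.pi * gaussSum χ ZMod.stdAddChar / q) *
      LFunction χ⁻¹ 0 := by
  have hq : (q : ℂ) ≠ 0 := by exact_mod_cast NeZero.ne q
  have hpi : (Real.pi : ℂ) ≠ 0 := by exact_mod_cast Real.pi_ne_zero
  set g := gaussSum χ ZMod.stdAddChar
  have h := ZMod.LFunction_one_sub (ZMod.dft (χ : ZMod q → ℂ)) (s := 1)
    (fun n hn => by
      have := congr_arg Complex.re hn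
      simp at this
      linarith [Nat.cast_nonneg (α := ℝ) n])
    -- At s = 1 the functional equation requires the function to vanish at 0, which oddness
    -- supplies.
    (Or.inl (by simp [hp.dft_eq_of_odd hχ, hχ.inv.apply_zero]))
  have e1 : ZMod.dft (ZMod.dft (χ : ZMod q → ℂ)) = fun j => -(q : ℂ) * χ j := by
    rw [ZMod.dft_dft]
    ext j
    rw [Odd.eval_neg χ j hχ, smul_eq_mul]
    ring
  have e2 : ZMod.dft (fun j => ZMod.dft (χ : ZMod q → ℂ) (-j)) = fun j => (q : ℂ) * χ j := by
    rw [ZMod.dft_comp_neg, e1]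
    ext j
    simp only [Odd.eval_neg χ j hχ]
    ring
  rw [e1, e2, hp.dft_eq_of_odd hχ, ZMod.LFunction_const_mul, ZMod.LFunction_const_mul,
    ZMod.LFunction_const_mul, sub_self, Complex.cpow_zero, Complex.cpow_neg_one, Complex.Gamma_one,
    mul_one, mul_one, mul_one, neg_mul (Real.pi : ℂ), neg_div, Complex.exp_neg,
    mul_div_right_comm, Complex.exp_pi_div_two_mul_I, Complex.inv_I] at h
  change -g * LFunction χ⁻¹ 0 = 1 * (2 * Real.pi : ℂ)⁻¹ *
    (Complex.I * (-q * LFunction χ 1) + -Complex.I * (q * LFunction χ 1)) at h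
  have h3 : Real.pi * g * LFunction χ⁻¹ 0 = Complex.I * q * LFunction χ 1 := by
    field_simp at h
    linear_combination (-1 / 2 : ℂ) * h
  field_simp
  linear_combination Complex.I * h3 + q * LFunction χ 1 * Complex.I_sq

/-- On the circle 1 - h/q is the class of -h/q, so by oddness both halves of the difference
contribute the same L-value. -/
lemma Odd.sum_mul_hurwitzDiff (hχ : χ.Odd) (s : ℂ) :
    ∑ h : ZMod q, χ h * hurwitzDiff (h.val / q) s = 2 * (q : ℂ) ^ s * LFunction χ s := by
  have hq : (q : ℂ) ≠ 0 := by exact_mod_cast NeZero.ne q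
  have e : ∀ h : ZMod q, hurwitzDiff (h.val / q) s =
      hurwitzZeta (ZMod.toAddCircle h) s - hurwitzZeta (ZMod.toAddCircle (-h)) s := fun h => by
    rw [hurwitzDiff, map_neg, ZMod.toAddCircle_apply, sub_eq_add_neg (1 : ℝ), AddCircle.coe_add,
      AddCircle.coe_period, zero_add, AddCircle.coe_neg]
  have h1 := hχ.sum_mul_neg fun h => hurwitzZeta (ZMod.toAddCircle h) s
  simp only [e, mul_sub, Finset.sum_sub_distrib]
  rw [h1, LFunction, ZMod.LFunction, Complex.cpow_neg]
  have : (q : ℂ) ^ s ≠ 0 := by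
    rw [Complex.cpow_ne_zero_iff]
    exact Or.inl hq
  field_simp
  ring

lemma IsPrimitive.twistedSigma_eq (hp : χ.IsPrimitive) (hχ : χ.Odd) (k : ℕ) (n : ℕ+) :
    twistedSigma k χ n = -(Complex.I * gaussSum χ ZMod.stdAddChar / q) *
      ∑ h : ZMod q, χ⁻¹ h * sinDivisorSum k (h.val / q) n := by
  simp only [twistedSigma, sinDivisorSum, Finset.mul_sum]
  rw [Finset.sum_comm]
  refine Finset.sum_congr rfl fun d _ => ?_
  rw [hp.apply_eq_sum_sin hχ, Finset.mul_sum, Finset.mul_sum]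
  exact Finset.sum_congr rfl fun h _ => by ring

/-- Writing r = h + qm turns m + h/q into r/q, so the sums over residues combine into one series
over pairs (d, r), which is then grouped by n = dr. -/
lemma Odd.hasSum_twistedSigmaBar (hχ : χ.Odd) (k : ℕ) {ν : ℂ} (hν : 0 < ν.re) {a x : ℝ}
    (ha : 0 < a) (hx : 0 < x) :
    HasSum (fun n : ℕ+ => twistedSigmaBar k χ n * (Complex.Gamma (ν + k + 1) /
        ((16 * Real.pi ^ 2 / (a ^ 2 * q) * ((n : ℕ) / x) + 1 : ℝ) : ℂ) ^ (ν + k + 1)))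
      (∑ h : ZMod q, χ h * ∑' p : ℕ+ × ℕ, ((p.1 : ℕ) : ℂ) ^ k *
        gammaQuot k ν a x p.1 (p.2 + h.val / q)) := by
  have hq : (0 : ℝ) < q := by exact_mod_cast NeZero.pos q
  set f : ℕ+ × ℕ → ℂ := fun p => χ p.2 * (((p.1 : ℕ) : ℂ) ^ k * gammaQuot k ν a x p.1 (p.2 / q))
    with hf
  have h1 : ∀ h : ZMod q, HasSum (fun p : ℕ+ × ℕ => if (p.2 : ZMod q) = h then f p else 0)
      (χ h * ∑' p : ℕ+ × ℕ, ((p.1 : ℕ) : ℂ) ^ k * gammaQuot k ν a x p.1 (p.2 + h.val / q)) := by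
    intro h
    have hinj : Function.Injective fun p : ℕ+ × ℕ => ((p.1, h.val + q * p.2) : ℕ+ × ℕ) := by
      rintro ⟨d, m⟩ ⟨d', m'⟩ hp
      simpa [NeZero.ne q] using hp
    rw [← hinj.hasSum_iff]
    · have hs : Summable fun p : ℕ+ × ℕ => χ h * (((p.1 : ℕ) : ℂ) ^ k *
          gammaQuot k ν a x p.1 (p.2 + h.val / q)) := by
        -- The class h = 0 would give the excluded parameter θ = 0; its weight χ(0) vanishes.
        rcases eq_or_ne h 0 with rfl | hh
        · simp only [hχ.apply_zero, zero_mul]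
          exact summable_zero
        · have : 0 < h.val := by
            rw [Nat.pos_iff_ne_zero]
            simpa using hh
          exact (summable_pow_mul_gammaQuot k hν ha hx (by positivity)).mul_left _
      rw [← tsum_mul_left]
      refine hs.hasSum.congr_fun fun p => ?_
      have e : (((h.val + q * p.2 : ℕ) : ℝ)) / q = p.2 + h.val / q := by
        push_cast
        field_simp
        ring
      simp only [hf, Function.comp, e]
      rw [if_pos (by simp)]
      simp
    · rintro ⟨d, r⟩ hr
      refine if_neg fun hrh => hr ⟨(d, r / q), ?_⟩
      subst hrh
      simp [ZMod.val_natCast, Nat.mod_add_div]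
  have h2 := hasSum_sum (s := Finset.univ) fun h _ => h1 h
  simp only [Finset.sum_ite_eq, Finset.mem_univ, if_true] at h2
  have hinj : Function.Injective fun p : ℕ+ × ℕ+ => ((p.1, (p.2 : ℕ)) : ℕ+ × ℕ) := by
    rintro ⟨d, m⟩ ⟨d', m'⟩ hp
    simpa using hp
  rw [← hinj.hasSum_iff] at h2
  · set G : ℕ → ℂ := fun n => Complex.Gamma (ν + k + 1) /
      ((16 * Real.pi ^ 2 / (a ^ 2 * q) * (n / x) + 1 : ℝ) : ℂ) ^ (ν + k + 1) with hG
    set F : ℕ → ℕ → ℂ := fun d r => (d : ℂ) ^ k * χ r * G (d * r) with hF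
    have h3 : HasSum (fun p : ℕ+ × ℕ+ => F p.1 p.2) _ := h2.congr_fun fun p => by
      change F p.1 p.2 = χ (p.2 : ℕ) * (((p.1 : ℕ) : ℂ) ^ k * gammaQuot k ν a x p.1 ((p.2 : ℕ) / q))
      rw [gammaQuot_div_eq]
      ring
    refine h3.sum_divisors.congr_fun fun n => ?_
    change twistedSigmaBar k χ n * G n = _
    rw [twistedSigmaBar, Finset.sum_mul]
    refine Finset.sum_congr rfl fun d hd => ?_
    simp only [hF]
    rw [Nat.mul_div_cancel' (Nat.dvd_of_mem_divisors hd)]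
  · rintro ⟨d, r⟩ hr
    have : r = 0 := by
      by_contra h
      exact hr ⟨(d, ⟨r, Nat.pos_of_ne_zero h⟩), rfl⟩
    subst this
    simp [hf, hχ.apply_zero]

end DirichletCharacter

/-! ### The character identity and the final theorem. -/

lemma ZMod.val_neg_div {q : ℕ} [NeZero q] {h : ZMod q} (hh : h ≠ 0) :
    (((-h).val : ℝ) / q) = 1 - h.val / q := by
  have : NeZero h := ⟨hh⟩
  have hq : (q : ℝ) ≠ 0 := by exact_mod_cast NeZero.ne q
  rw [ZMod.val_neg_of_ne_zero, Nat.cast_sub h.val_lt.le, sub_div, div_self hq]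

/-- Sum the trigonometric identities at θ = h/q with weights χ̄(h), then multiply by -iτ(χ)/q. In
the dual series 1 - h/q belongs to -h, so oddness doubles the contribution of h. -/
theorem charIdentity_of_trigIdentity {k : ℕ} {ν : ℂ} (hν : 0 < ν.re) {a x : ℝ} (ha : 0 < a)
    (hx : 0 < x) (H : ∀ θ : ℝ, 0 < θ → θ < 1 → TrigIdentity k ν a x θ) {q : ℕ} [NeZero q]
    {χ : DirichletCharacter ℂ q} (hp : χ.IsPrimitive) (hχ : χ.Odd) : CharIdentity k ν a x q χ := by
  have hq : (0 : ℝ) < q := by exact_mod_cast NeZero.pos q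
  have hqc : (q : ℂ) ≠ 0 := by exact_mod_cast NeZero.ne q
  have hθ : ∀ h : ZMod q, h ≠ 0 → 0 < (h.val : ℝ) / q ∧ (h.val : ℝ) / q < 1 := fun h hh => by
    have h0 : 0 < h.val := by
      rw [Nat.pos_iff_ne_zero]
      simpa using hh
    exact ⟨by positivity, (div_lt_one hq).2 (by exact_mod_cast h.val_lt)⟩
  have hψ0 := hχ.inv.apply_zero
  have hW : ∀ h : ZMod q, Summable fun n : ℕ+ =>
      χ⁻¹ h * (besselWeight ν a x n * sinDivisorSum k (h.val / q) n) := fun h => by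
    rcases eq_or_ne h 0 with rfl | hh
    · simp only [hψ0, zero_mul]
      exact summable_zero
    · exact (H _ (hθ h hh).1 (hθ h hh).2).1.mul_left _
  have hL := (hasSum_sum (s := Finset.univ) fun h _ => (hW h).hasSum).mul_left
    (-(Complex.I * gaussSum χ ZMod.stdAddChar / q))
  have hL' := hL.congr_fun (g := fun n : ℕ+ => twistedSigma k χ n * besselWeight ν a x n)
    fun n => by
      rw [hp.twistedSigma_eq hχ, mul_assoc, Finset.sum_mul]
      congr 1
      exact Finset.sum_congr rfl fun h _ => by ring
  set U : ZMod q → ℂ := fun h => ∑' p : ℕ+ × ℕ, ((p.1 : ℕ) : ℂ) ^ k *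
    gammaQuot k ν a x p.1 (p.2 + h.val / q) with hU
  have hR : HasSum _ (∑ h, χ⁻¹ h * U h) := hχ.inv.hasSum_twistedSigmaBar k hν ha hx
  refine ⟨hL'.summable, hR.summable, ?_⟩
  rw [hL'.tsum_eq, hR.tsum_eq]
  set Y : ℂ := ((a ^ 2 * x / 4 : ℝ) : ℂ) ^ (ν / 2 + k + 1) with hY
  have hS : ∀ h : ZMod q, h ≠ 0 → ∑' d : ℕ+, ((d : ℕ) : ℂ) ^ k * ∑' m : ℕ,
      (gammaQuot k ν a x d (m + h.val / q) - gammaQuot k ν a x d (m + 1 - h.val / q)) =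
      U h - U (-h) := fun h hh => by
    have s1 := summable_pow_mul_gammaQuot k hν ha hx (hθ h hh).1
    have s2 := summable_pow_mul_gammaQuot k hν ha hx (hθ (-h) (neg_ne_zero.2 hh)).1
    have s3 := (H _ (hθ h hh).1 (hθ h hh).2).2.1
    simp only [hU]
    rw [← s1.tsum_sub s2]
    simp only [← mul_sub, ZMod.val_neg_div hh, ← add_sub_assoc]
    rw [s3.tsum_prod]
    simp only [tsum_mul_left]
  set ε : ℂ := (-1) ^ (k / 2)
  have hterm : ∀ h : ZMod q, Y * ∑' n : ℕ+,
      χ⁻¹ h * (besselWeight ν a x n * sinDivisorSum k (h.val / q) n) =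
      -(ε * (a : ℂ) ^ (2 * k + 2) * (k.factorial : ℂ) /
        (2 ^ (2 * k + 4) * (2 * (Real.pi : ℂ)) ^ (k + 1))) *
        Complex.Gamma ν * (x : ℂ) ^ (k + 1) * (χ⁻¹ h * hurwitzDiff (h.val / q) (1 + k))
      + deltaK k * ((Real.pi : ℂ) * Complex.Gamma (1 + ν) / 4) *
        (χ⁻¹ h * hurwitzDiff (h.val / q) 0)
      + ε / 4 * (2 * (Real.pi : ℂ)) ^ (k + 1) * (χ⁻¹ h * U h - χ⁻¹ h * U (-h)) := fun h => by
    rw [tsum_mul_left]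
    rcases eq_or_ne h 0 with rfl | hh
    · simp [hψ0]
    · have := (H _ (hθ h hh).1 (hθ h hh).2).2.2
      rw [hS h hh] at this
      linear_combination χ⁻¹ h * this
  have hsum : Y * ∑ h : ZMod q, ∑' n : ℕ+,
      χ⁻¹ h * (besselWeight ν a x n * sinDivisorSum k (h.val / q) n) =
      -(ε * (a : ℂ) ^ (2 * k + 2) * (k.factorial : ℂ) /
        (2 ^ (2 * k + 4) * (2 * (Real.pi : ℂ)) ^ (k + 1))) *
        Complex.Gamma ν * (x : ℂ) ^ (k + 1) *
        (2 * ((q : ℂ) ^ k * q) * DirichletCharacter.LFunction χ⁻¹ (1 + k))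
      + deltaK k * ((Real.pi : ℂ) * Complex.Gamma (1 + ν) / 4) *
        (2 * DirichletCharacter.LFunction χ⁻¹ 0)
      + ε / 4 * (2 * (Real.pi : ℂ)) ^ (k + 1) * (2 * ∑ h, χ⁻¹ h * U h) := by
    have e : (q : ℂ) ^ (1 + k : ℂ) = (q : ℂ) ^ k * q := by
      rw [← pow_succ, ← Complex.cpow_natCast]
      push_cast
      rw [add_comm]
    rw [Finset.mul_sum, Finset.sum_congr rfl fun h _ => hterm h, Finset.sum_add_distrib,
      Finset.sum_add_distrib, ← Finset.mul_sum, ← Finset.mul_sum, ← Finset.mul_sum,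
      Finset.sum_sub_distrib, hχ.inv.sum_mul_neg, hχ.inv.sum_mul_hurwitzDiff,
      hχ.inv.sum_mul_hurwitzDiff, Complex.cpow_zero, e]
    ring
  rw [hp.LFunction_one_of_odd hχ, mul_left_comm, hsum]
  have hpw : (2 : ℂ) ^ (2 * k + 4) = 2 * 2 ^ (2 * k + 3) := by ring
  rw [hpw]
  field_simp
  ring

theorem theorem2p1 (k : ℕ) (hk : Even k) (ν : ℂ) (hν : 0 < ν.re) (a x : ℝ)
    (ha : 0 < a) (hx : 0 < x) :
    (∀ θ : ℝ, 0 < θ → θ < 1 → TrigIdentity k ν a x θ) ∧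
    ((∀ θ : ℝ, 0 < θ → θ < 1 → TrigIdentity k ν a x θ) ↔
      (∀ (q : ℕ) [NeZero q] (χ : DirichletCharacter ℂ q),
        χ.IsPrimitive → χ.Odd → CharIdentity k ν a x q χ)) := by
  have H : ∀ θ : ℝ, 0 < θ → θ < 1 → TrigIdentity k ν a x θ :=
    fun θ h0 h1 => trigIdentity hk hν ha hx h0 h1
  exact ⟨H, fun H' q _ χ hp hχ => charIdentity_of_trigIdentity hν ha hx H' hp hχ, fun _ => H⟩
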